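/- Let $k\ge 0$ and let $L\subset\mathbb C^k$ be a lattice (a discrete subgroup spanning $\mathbb C^k$ over $\mathbb R$). Let $\mathbb H$ be the quaternions with units $I,J,K=IJ$, with $\mathbb C=\mathbb R+\mathbb R I\subset\mathbb H$, so that $L\subset\mathbb C^k\subset V_{\mathbb H}:=\mathbb H^k=\{q+pJ: q,p\in\mathbb C^k\}$, a left $\mathbb H$-module with its standard Euclidean metric $g$. Parametrize $\mathbb P^1$ by $\psi^{(1)}(\zeta)=[\zeta:1]$, $\psi^{(2)}(\xi)=[1:\xi]$, and let $\mathcal O(d)$ be the line bundle glued from two trivial ones by $(w,\psi^{(1)}(\zeta))\sim(\xi^d w,\psi^{(2)}(\xi))$, $\zeta\xi=1$. Put $h^{(1)}_\zeta=1+\zeta K$, $h^{(2)}_\xi=\bar\xi+K$, and $U^{(i)}_z=h^{(i)}_z\,U\,(h^{(i)}_z)^{-1}$ for $U\in\{I,J,K\}$. For imaginary unit quaternions let $\omega_u(a,b)=g(ua,b)$ and $\Omega_{(u_1,u_2)}=\omega_{u_1}+i\omega_{u_2}$. Let $\alpha$ be the antipodal map $[z_1:z_2]\mapsto[-\bar z_2:\bar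 z_1]$ of $\mathbb P^1$, lifted to $\mathcal O(2)$ by $(w,\psi^{(1)}(\zeta))\mapsto(\bar w,\psi^{(2)}(-\bar\zeta))$, $(w,\psi^{(2)}(\xi))\mapsto(\bar w,\psi^{(1)}(-\bar\xi))$. Let $Z=(V_{\mathbb H}\times\mathbb P^1)/L$ be the quotient by translations of the first factor, $\Pi:Z\to\mathbb P^1$ the projection, and $l_v(x)=[(v,x)]$ for $v\in V_{\mathbb H}$ the twistor lines. Then: 1. $Z$ is Hausdorff and second countable, and is a complex manifold of dimension $2k+1$ for which the maps $\mathbb C^{2k}\times\mathbb C\to Z$, $((q,p),z)\mapsto[((1+z\bar z)^{-1}h^{(i)}_z(q+pJ),\psi^{(i)}(z))]$, $i=1,2$, are local biholomorphisms. The quotient map $V_{\mathbb H}\times\mathbb P^1\to Z$ is a local diffeomorphism of real smooth manifolds. $\Pi$ is a surjective holomorphic submersion, and its fiber over $\psi^{(i)}(z)$ is $V_{\mathbb H}/L$ with complex structure left multiplication by $I^{(i)}_z$. 2. Each $l_v$ is a holomorphic section of $\Pi$ whose normal bundle is isomorphic, as a holomorphic vector bundle, to $\mathbb C^{2k}\otimes\mathcal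 O(1)$. 3. There is a holomorphic exterior $2$-form $\Omega$ along the fibers of $\Pi$ (a holomorphic section of $\Lambda^2 T_\Pi^*\otimes\Pi^*\mathcal O(2)$, where $T_\Pi=\ker d\Pi$), which is closed and nondegenerate on every fiber of $\Pi$; over $\psi^{(i)}(z)$, in the $i$-th trivialization of $\mathcal O(2)$, it is $(1+z\bar z)\,\Omega_{(J^{(i)}_z,K^{(i)}_z)}$. 4. There is an anti-holomorphic involution $\widetilde\alpha$ of $Z$ which covers $\alpha$, maps each twistor line $l_v$ onto itself, and satisfies $\widetilde\alpha^*\Omega=-\overline\Omega$, where $\Omega(d\widetilde\alpha\,X,d\widetilde\alpha\,Y)$ and $-\Omega(X,Y)$ are compared by the above anti-linear lift of $\alpha$ to $\mathcal O(2)$. -/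

import Mathlib

open scoped Manifold ContDiff Quaternion LinearAlgebra.Projectivization ComplexConjugate
open Bundle Set

noncomputable section

namespace HKTwistor

/-! ## The complex projective line -/

/-- The complex projective line: complex lines in `ℂ²`. -/
def P1 : Type := ℙ ℂ (Fin 2 → ℂ)

/-- The quotient topology from `ℂ² ∖ {0}`. -/
instance : TopologicalSpace P1 :=
  inferInstanceAs (TopologicalSpace (Quotient (projectivizationSetoid ℂ (Fin 2 → ℂ))))

namespace P1

/-- The line spanned by a nonzero vector. -/
def mk (v : Fin 2 → ℂ) (hv : v ≠ 0) : P1 := Projectivization.mk ℂ v hv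

theorem isQuotientMap_mk :
    Topology.IsQuotientMap (fun v : {v : Fin 2 → ℂ // v ≠ 0} => mk v.1 v.2) :=
  isQuotientMap_quotient_mk'

theorem exists_rep (x : P1) : ∃ (v : Fin 2 → ℂ) (hv : v ≠ 0), x = mk v hv :=
  ⟨Projectivization.rep x, Projectivization.rep_nonzero x, (Projectivization.mk_rep x).symm⟩

/-- The affine coordinate `z_i / z_{1-i}`: for `i = 0` this is `ζ = z₁/z₂` and for `i = 1` this is
`ξ = z₂/z₁`. It is only meaningful on the affine patch `patch i`. -/
def coord (i : Fin 2) : P1 → ℂ :=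
  Projectivization.lift (fun v : {v : Fin 2 → ℂ // v ≠ 0} => v.1 i / v.1 (1 - i)) (by
    intro a b t h
    have ht : t ≠ 0 := by
      rintro rfl
      exact a.2 (by simpa using h)
    simp only [h, Pi.smul_apply, smul_eq_mul]
    exact mul_div_mul_left _ _ ht)

/-- The affine patch where `z_{1-i} ≠ 0`; `patch 0` is `𝔸₁` and `patch 1` is `𝔸₂`. -/
def patch (i : Fin 2) : Set P1 :=
  {x | Projectivization.lift (fun v : {v : Fin 2 → ℂ // v ≠ 0} => v.1 (1 - i) ≠ 0) (by
    intro a b t h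
    have ht : t ≠ 0 := by
      rintro rfl
      exact a.2 (by simpa using h)
    simp [h, ht]) x}

theorem update_ne_zero (i : Fin 2) (z : ℂ) : Function.update (fun _ : Fin 2 => (1 : ℂ)) i z ≠ 0 := by
  intro h
  have := congrFun h (1 - i)
  fin_cases i <;> simp at this

/-- The parametrizations of the patches: `psi 0 ζ = [ζ : 1]` and `psi 1 ξ = [1 : ξ]`. -/
def psi (i : Fin 2) (z : ℂ) : P1 := mk (Function.update (fun _ => 1) i z) (update_ne_zero i z)

@[simp] theorem coord_mk (i : Fin 2) (v : Fin 2 → ℂ) (hv : v ≠ 0) :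
    coord i (mk v hv) = v i / v (1 - i) := rfl

@[simp] theorem mem_patch_mk (i : Fin 2) (v : Fin 2 → ℂ) (hv : v ≠ 0) :
    mk v hv ∈ patch i ↔ v (1 - i) ≠ 0 := Iff.rfl

theorem psi_mem (i : Fin 2) (z : ℂ) : psi i z ∈ patch i := by
  fin_cases i <;> simp [psi]

theorem coord_psi (i : Fin 2) (z : ℂ) : coord i (psi i z) = z := by
  fin_cases i <;> simp [psi]

theorem psi_coord (i : Fin 2) {x : P1} (hx : x ∈ patch i) : psi i (coord i x) = x := by
  obtain ⟨v, hv, rfl⟩ := exists_rep x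
  rw [mem_patch_mk] at hx
  refine (Projectivization.mk_eq_mk_iff' ℂ _ _ _ _).2 ⟨(v (1 - i))⁻¹, ?_⟩
  ext j
  fin_cases i <;> fin_cases j <;> simp_all [div_eq_inv_mul]

theorem isOpen_patch (i : Fin 2) : IsOpen (patch i) := by
  rw [← isQuotientMap_mk.isOpen_preimage]
  have : Continuous (fun v : {v : Fin 2 → ℂ // v ≠ 0} => v.1 (1 - i)) :=
    (continuous_apply _).comp continuous_subtype_val
  exact this.isOpen_preimage _ (isOpen_compl_singleton (x := (0 : ℂ)))

theorem continuousOn_coord (i : Fin 2) : ContinuousOn (coord i) (patch i) := by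
  rw [isQuotientMap_mk.continuousOn_isOpen_iff (isOpen_patch i)]
  have h1 : Continuous (fun v : {v : Fin 2 → ℂ // v ≠ 0} => v.1 (1 - i)) :=
    (continuous_apply _).comp continuous_subtype_val
  have h2 : Continuous (fun v : {v : Fin 2 → ℂ // v ≠ 0} => v.1 i) :=
    (continuous_apply _).comp continuous_subtype_val
  exact ContinuousOn.div h2.continuousOn h1.continuousOn fun v hv => hv

theorem continuous_psi (i : Fin 2) : Continuous (psi i) := by
  have h : Continuous (fun z : ℂ => Function.update (fun _ : Fin 2 => (1 : ℂ)) i z) :=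
    continuous_const.update i continuous_id
  exact isQuotientMap_mk.continuous.comp (h.subtype_mk (update_ne_zero i))

/-- The affine charts. -/
def chart (i : Fin 2) : OpenPartialHomeomorph P1 ℂ where
  toFun := coord i
  invFun := psi i
  source := patch i
  target := univ
  map_source' _ _ := mem_univ _
  map_target' z _ := psi_mem i z
  left_inv' _ hx := psi_coord i hx
  right_inv' z _ := coord_psi i z
  open_source := isOpen_patch i
  open_target := isOpen_univ
  continuousOn_toFun := continuousOn_coord i
  continuousOn_invFun := (continuous_psi i).continuousOn

open Classical in
/-- A patch containing the given point. -/
def index (x : P1) : Fin 2 := if x ∈ patch 0 then 0 else 1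

theorem mem_patch_index (x : P1) : x ∈ patch (index x) := by
  unfold index
  split_ifs with h
  · exact h
  · obtain ⟨v, hv, rfl⟩ := exists_rep x
    rw [mem_patch_mk] at h ⊢
    intro h0
    apply hv
    ext j
    fin_cases j <;> simp_all

instance : ChartedSpace ℂ P1 where
  atlas := range chart
  chartAt x := chart (index x)
  mem_chart_source x := mem_patch_index x
  chart_mem_atlas _ := mem_range_self _

theorem coord_ne_zero {i : Fin 2} {x : P1} (h : x ∈ patch i) (h' : x ∈ patch (1 - i)) :
    coord i x ≠ 0 := by
  obtain ⟨v, hv, rfl⟩ := exists_rep x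
  rw [mem_patch_mk] at h h'
  rw [coord_mk]
  exact div_ne_zero (by simpa using h') h

theorem coord_mul_coord {x : P1} (h : x ∈ patch 0) (h' : x ∈ patch 1) :
    coord 0 x * coord 1 x = 1 := by
  obtain ⟨v, hv, rfl⟩ := exists_rep x
  rw [mem_patch_mk] at h h'
  simp only [coord_mk]
  have h0 : v 0 ≠ 0 := by simpa using h'
  have h1 : v 1 ≠ 0 := by simpa using h
  simp only [sub_zero, sub_self]
  field_simp

instance : IsManifold 𝓘(ℂ, ℂ) ω P1 := by
  refine isManifold_of_contDiffOn _ _ _ ?_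
  rintro _ _ ⟨i, rfl⟩ ⟨j, rfl⟩
  simp only [modelWithCornersSelf_coe, modelWithCornersSelf_coe_symm, Function.comp_id,
    Function.id_comp, preimage_id, range_id, inter_univ]
  by_cases hij : j = i
  · subst hij
    refine contDiffOn_id.congr fun z _ => ?_
    exact coord_psi j z
  · refine (contDiffOn_inv ℂ (𝕜' := ℂ)).congr_mono (s₁ := _) (fun z hz => ?_) fun z hz => ?_
    · have hz2 : psi i z ∈ patch j := by
        simpa [OpenPartialHomeomorph.trans_source, chart] using hz
      change coord j (psi i z) = z⁻¹
      fin_cases i <;> fin_cases j <;> simp_all [psi]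
    · have hz2 : psi i z ∈ patch j := by
        simpa [OpenPartialHomeomorph.trans_source, chart] using hz
      fin_cases i <;> fin_cases j <;> simp_all [psi]

end P1

/-- The anti-linear map `(z₁, z₂) ↦ (-z̄₂, z̄₁)` of `ℂ²`. -/
def antipodalLift : (Fin 2 → ℂ) →ₛₗ[starRingEnd ℂ] (Fin 2 → ℂ) where
  toFun v := ![-conj (v 1), conj (v 0)]
  map_add' v w := by
    ext j
    fin_cases j <;> simp [add_comm]
  map_smul' c v := by
    ext j
    fin_cases j <;> simp

theorem antipodalLift_injective : Function.Injective antipodalLift := by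
  intro v w h
  have h0 := congrFun h 0
  have h1 := congrFun h 1
  simp only [antipodalLift, LinearMap.coe_mk, AddHom.coe_mk, Matrix.cons_val_zero,
    Matrix.cons_val_one, neg_inj] at h0 h1
  ext j
  fin_cases j
  · exact (starRingEnd ℂ).injective h1
  · exact (starRingEnd ℂ).injective h0

/-- The antipodal map of the projective line. -/
def antipodal : P1 → P1 := Projectivization.map antipodalLift antipodalLift_injective

/-! ## The line bundles `𝒪(d)` -/

open Classical in
/-- The holomorphic line bundle `𝒪(d)`: the gluing of `ℂ × 𝔸₁` and `ℂ × 𝔸₂` under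
`(w, ψ⁽¹⁾(ζ)) ∼ (ξ ^ d * w, ψ⁽²⁾(ξ))` for `ζ ξ = 1`. -/
def lineBundle (d : ℤ) : VectorBundleCore ℂ P1 ℂ (Fin 2) where
  baseSet := P1.patch
  isOpen_baseSet := P1.isOpen_patch
  indexAt := P1.index
  mem_baseSet_at := P1.mem_patch_index
  coordChange i j x :=
    if i = j then ContinuousLinearMap.id ℂ ℂ
    else (P1.coord j x ^ d) • ContinuousLinearMap.id ℂ ℂ
  coordChange_self i x _ v := by simp
  continuousOn_coordChange i j := by
    by_cases hij : i = j
    · simp only [hij, if_true]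
      exact continuousOn_const
    · simp only [hij, if_false]
      have hi : i = 1 - j := by fin_cases i <;> fin_cases j <;> simp_all
      refine ContinuousOn.smul (ContinuousOn.zpow₀
        ((P1.continuousOn_coord j).mono inter_subset_right) d fun x hx => Or.inl ?_)
        continuousOn_const
      exact P1.coord_ne_zero hx.2 (hi ▸ hx.1)
  coordChange_comp i j k x hx v := by
    obtain ⟨⟨hi, hj⟩, hk⟩ := hx
    by_cases hij : i = j
    · subst hij; simp
    by_cases hjk : j = k
    · subst hjk; simp
    have hik : i = k := by fin_cases i <;> fin_cases j <;> fin_cases k <;> simp_all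
    subst hik
    have : P1.coord i x * P1.coord j x = 1 := by
      fin_cases i <;> fin_cases j
      · simp_all
      · exact P1.coord_mul_coord hi hj
      · exact (mul_comm _ _).trans (P1.coord_mul_coord hj hi)
      · simp_all
    simp [hij, hjk, ← mul_assoc, ← mul_zpow, this]

/-- The total space of `𝒪(d)`. -/
abbrev LineTotal (d : ℤ) : Type := TotalSpace ℂ (lineBundle d).Fiber

instance (d : ℤ) : (lineBundle d).IsContMDiff 𝓘(ℂ, ℂ) ω where
  contMDiffOn_coordChange i j := by
    by_cases hij : i = j
    · simp only [lineBundle, hij, if_true]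
      exact contMDiffOn_const
    · have hi : i = 1 - j := by fin_cases i <;> fin_cases j <;> simp_all
      have hc : ContMDiffOn 𝓘(ℂ, ℂ) 𝓘(ℂ, ℂ) ω (P1.coord j) (P1.patch i ∩ P1.patch j) :=
        (contMDiffOn_of_mem_maximalAtlas (e := P1.chart j)
          (IsManifold.subset_maximalAtlas (mem_range_self j))).mono inter_subset_right
      have hz : ContDiffOn ℂ ω (fun z : ℂ => z ^ d) {0}ᶜ := fun z hz =>
        ((analyticAt_id (𝕜 := ℂ)).zpow hz).contDiffAt.contDiffWithinAt
      have hp : ContDiffOn ℂ ω (fun z : ℂ => (z ^ d) • ContinuousLinearMap.id ℂ ℂ) {0}ᶜ :=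
        hz.smul contDiffOn_const
      have := hp.contMDiffOn.comp hc fun x hx => P1.coord_ne_zero hx.2 (hi ▸ hx.1)
      refine this.congr fun x _ => ?_
      simp [lineBundle, hij]

/-- The fiber coordinate of a point of `𝒪(d)` in the `i`-th trivialization. -/
def fiberCoord (d : ℤ) (i : Fin 2) (p : LineTotal d) : ℂ := ((lineBundle d).localTriv i p).2

/-- The anti-holomorphic lift of the antipodal map to `𝒪(d)`, `d` even:
`(w, ψ⁽¹⁾(ζ)) ↦ (w̄, ψ⁽²⁾(-ζ̄))` and `(w, ψ⁽²⁾(ξ)) ↦ (w̄, ψ⁽¹⁾(-ξ̄))`.  (For even `d` the two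
formulas agree on the overlap; here the trivialization `P1.index p.proj` is used.) -/
def lineConj (d : ℤ) (p : LineTotal d) : LineTotal d :=
  ⟨antipodal p.proj,
    (lineBundle d).coordChange (1 - P1.index p.proj) (P1.index (antipodal p.proj))
      (antipodal p.proj) (conj (fiberCoord d (P1.index p.proj) p))⟩

/-! ## Holomorphic geometry of a complex manifold over the projective line -/

section Geometry

variable {E : Type} [NormedAddCommGroup E] [NormedSpace ℂ E]
  {M : Type} [TopologicalSpace M] [ChartedSpace E M] [IsManifold 𝓘(ℂ, E) ω M]

/-- The vertical tangent space: the kernel of the differential of `pr`. -/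
def Vert (pr : M → P1) (z : M) : Submodule ℂ (TangentSpace 𝓘(ℂ, E) z) :=
  LinearMap.ker (mfderiv 𝓘(ℂ, E) 𝓘(ℂ, ℂ) pr z).toLinearMap

/-- A holomorphic fibration over the projective line: a surjective holomorphic submersion. -/
def IsHolomorphicFibration (pr : M → P1) : Prop :=
  ContMDiff 𝓘(ℂ, E) 𝓘(ℂ, ℂ) ω pr ∧ Function.Surjective pr ∧
    ∀ z, Function.Surjective (mfderiv 𝓘(ℂ, E) 𝓘(ℂ, ℂ) pr z)

/-- An exterior `2`-form along the fibers of `pr` with values in `pr^* 𝒪(2)`. -/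
abbrev RelForm (pr : M → P1) : Type :=
  (z : M) → (Vert (E := E) pr z) [⋀^Fin 2]→L[ℂ] ((lineBundle 2).Fiber (pr z))

/-- The form is holomorphic: it takes local holomorphic vertical vector fields to holomorphic
sections of `pr^* 𝒪(2)`, i.e. to holomorphic maps to the total space of `𝒪(2)` lying over `pr`. -/
def RelForm.IsHolomorphic {pr : M → P1} (Ω : RelForm (E := E) pr) : Prop :=
  ∀ U : Set M, IsOpen U → ∀ X Y : (z : M) → Vert (E := E) pr z,
    ContMDiffOn 𝓘(ℂ, E) 𝓘(ℂ, E).tangent ω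
      (fun z => (⟨z, (X z : TangentSpace 𝓘(ℂ, E) z)⟩ : TangentBundle 𝓘(ℂ, E) M)) U →
    ContMDiffOn 𝓘(ℂ, E) 𝓘(ℂ, E).tangent ω
      (fun z => (⟨z, (Y z : TangentSpace 𝓘(ℂ, E) z)⟩ : TangentBundle 𝓘(ℂ, E) M)) U →
    ContMDiffOn 𝓘(ℂ, E) (𝓘(ℂ, ℂ).prod 𝓘(ℂ, ℂ)) ω
      (fun z => (⟨pr z, Ω z ![X z, Y z]⟩ : LineTotal 2)) U

/-- The form is nondegenerate on every fiber. -/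
def RelForm.IsNondegenerate {pr : M → P1} (Ω : RelForm (E := E) pr) : Prop :=
  ∀ z (X : Vert (E := E) pr z), (∀ Y : Vert (E := E) pr z, Ω z ![X, Y] = 0) → X = 0

/-- The form is closed on every fiber: its pull-back by every holomorphic map `φ` from an open
subset `U` of some `ℂᵐ` into a fiber of `pr` is closed (the values of this pull-back lie in one
fixed line of `𝒪(2)`, which is `ℂ` as a complex vector space).  Here `D u` is the differential of
`φ`, considered as a map to the vertical tangent space. -/
def RelForm.IsFiberwiseClosed {pr : M → P1} (Ω : RelForm (E := E) pr) : Prop :=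
  ∀ (m : ℕ) (U : Set (Fin m → ℂ)), IsOpen U →
    ∀ φ : (Fin m → ℂ) → M, ContMDiffOn 𝓘(ℂ, Fin m → ℂ) 𝓘(ℂ, E) ω φ U →
    ∀ x₀ : P1, (∀ u ∈ U, pr (φ u) = x₀) →
    ∀ D : (u : Fin m → ℂ) → (Fin m → ℂ) →L[ℂ] Vert (E := E) pr (φ u),
      (∀ u ∈ U, ∀ w : Fin m → ℂ,
        (D u w : TangentSpace 𝓘(ℂ, E) (φ u)) = mfderiv 𝓘(ℂ, Fin m → ℂ) 𝓘(ℂ, E) φ u w) →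
      ∀ u ∈ U, extDeriv (𝕜 := ℂ) (E := Fin m → ℂ) (F := ℂ)
        (fun u' => (Ω (φ u')).compContinuousLinearMap (D u')) u = 0

/-- A holomorphic section of `pr`. -/
def IsHolomorphicSection (pr : M → P1) (s : P1 → M) : Prop :=
  ContMDiff 𝓘(ℂ, ℂ) 𝓘(ℂ, E) ω s ∧ ∀ x, pr (s x) = x

/-- The fiber at `x` of the normal bundle of the curve `s`. -/
abbrev NormalSpace (s : P1 → M) (x : P1) : Type :=
  TangentSpace 𝓘(ℂ, E) (s x) ⧸ LinearMap.range (mfderiv 𝓘(ℂ, ℂ) 𝓘(ℂ, E) s x).toLinearMap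

/-- A section over `U` of the normal bundle `s^* TM / T P¹` is holomorphic if it lifts locally to
a holomorphic section of `s^* TM`. -/
def IsHolomorphicNormalSection (s : P1 → M) (U : Set P1)
    (σ : (x : P1) → NormalSpace (E := E) s x) : Prop :=
  ∀ x ∈ U, ∃ W : Set P1, IsOpen W ∧ x ∈ W ∧ W ⊆ U ∧
    ∃ Y : (y : P1) → TangentSpace 𝓘(ℂ, E) (s y),
      ContMDiffOn 𝓘(ℂ, ℂ) 𝓘(ℂ, E).tangent ω
        (fun y => (⟨s y, Y y⟩ : TangentBundle 𝓘(ℂ, E) M)) W ∧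
      ∀ y ∈ W, (Submodule.Quotient.mk (Y y) : NormalSpace (E := E) s y) = σ y

/-- The normal bundle of `s` is isomorphic, as a holomorphic vector bundle, to
`ℂⁿ ⊗ 𝒪(d) = 𝒪(d) ⊕ ⋯ ⊕ 𝒪(d)`: there are fiberwise linear isomorphisms which match the
holomorphic local sections of both bundles. -/
def NormalBundleIso (s : P1 → M) (n : ℕ) (d : ℤ) : Prop :=
  ∃ Φ : (x : P1) → NormalSpace (E := E) s x ≃ₗ[ℂ] (Fin n → (lineBundle d).Fiber x),
    ∀ U : Set P1, IsOpen U → ∀ σ : (x : P1) → NormalSpace (E := E) s x,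
      IsHolomorphicNormalSection s U σ ↔
        ∀ j : Fin n, ContMDiffOn 𝓘(ℂ, ℂ) (𝓘(ℂ, ℂ).prod 𝓘(ℂ, ℂ)) ω
          (fun x => (⟨x, Φ x (σ x) j⟩ : LineTotal d)) U

variable [NormedSpace ℝ E] [IsScalarTower ℝ ℂ E]

/-- The real differential of a self-map of a complex manifold. -/
def realDeriv (τ : M → M) (z : M) (X : TangentSpace 𝓘(ℂ, E) z) :
    TangentSpace 𝓘(ℂ, E) (τ z) :=
  (mfderiv 𝓘(ℝ, E) 𝓘(ℝ, E) τ z : E →L[ℝ] E) X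

/-- An anti-holomorphic self-map: real differentiable with anti-linear differential. -/
def IsAntiholomorphic (τ : M → M) : Prop :=
  MDifferentiable 𝓘(ℝ, E) 𝓘(ℝ, E) τ ∧
    ∀ z (X : TangentSpace 𝓘(ℂ, E) z),
      realDeriv (E := E) τ z (Complex.I • X) = -(Complex.I • realDeriv (E := E) τ z X)

/-- `τ^* Ω = - Ω̄` for a self-map `τ` covering the antipodal map: the differential of `τ` preserves
vertical vectors, and `Ω (dτ X, dτ Y)` is the image of `- Ω (X, Y)` under the anti-linear lift of
the antipodal map to `𝒪(2)`. -/
def RelForm.IsAntiReal {pr : M → P1} (Ω : RelForm (E := E) pr) (τ : M → M) : Prop :=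
  ∀ z, ∃ h : ∀ X : Vert (E := E) pr z,
      realDeriv (E := E) τ z (X : TangentSpace 𝓘(ℂ, E) z) ∈ Vert (E := E) pr (τ z),
    ∀ X Y : Vert (E := E) pr z,
      (⟨pr (τ z), Ω (τ z) ![⟨_, h X⟩, ⟨_, h Y⟩]⟩ : LineTotal 2) =
        lineConj 2 ⟨pr z, -(Ω z ![X, Y])⟩

end Geometry

/-! ## The quaternionic vector space and its hyper-Kähler structure -/

/-- The quaternionic vector space `ℍᵏ`, with left multiplication. -/
abbrev VH (k : ℕ) : Type := Fin k → ℍ[ℝ]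

/-- The quaternion unit `I`. -/
def qI : ℍ[ℝ] := ⟨0, 1, 0, 0⟩

/-- The quaternion unit `J`. -/
def qJ : ℍ[ℝ] := ⟨0, 0, 1, 0⟩

/-- The quaternion unit `K = IJ`. -/
def qK : ℍ[ℝ] := ⟨0, 0, 0, 1⟩

/-- The Riemannian metric `g` on `ℍᵏ`. -/
def metric {k : ℕ} (a b : VH k) : ℝ := ∑ j, (a j * star (b j)).re

/-- The Kähler form `ω_u (a, b) = g (u a, b)`. -/
def kahlerForm {k : ℕ} (u : ℍ[ℝ]) (a b : VH k) : ℝ := metric (u • a) b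

/-- The complex symplectic form `Ω_{(u₁,u₂)} = ω_{u₁} + i ω_{u₂}`. -/
def complexForm {k : ℕ} (u₁ u₂ : ℍ[ℝ]) (a b : VH k) : ℂ :=
  kahlerForm u₁ a b + Complex.I * kahlerForm u₂ a b

/-- The quaternions `1 + ζ K` (for `i = 0`) and `ξ̄ + K` (for `i = 1`). -/
def frame (i : Fin 2) (z : ℂ) : ℍ[ℝ] := if i = 0 then 1 + Quaternion.coeComplex z * qK else Quaternion.coeComplex (conj z) + qK

/-- Conjugation by `frame i z`. Applied to `I` this is stereographic projection, i.e. the imaginary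
unit quaternion corresponding to `P1.psi i z`. -/
def rotate (i : Fin 2) (z : ℂ) (u : ℍ[ℝ]) : ℍ[ℝ] := frame i z * u * (frame i z)⁻¹

/-- The form `Ω⁽ⁱ⁾_z = (1 + z z̄) Ω_{(J⁽ⁱ⁾_z, K⁽ⁱ⁾_z)}` on `ℍᵏ`. -/
def stdForm {k : ℕ} (i : Fin 2) (z : ℂ) (a b : VH k) : ℂ :=
  (1 + z * conj z) * complexForm (rotate i z qJ) (rotate i z qK) a b

/-! ## The twistor space -/

/-- The model space `ℂ²ᵏ × ℂ`, with points `((q, p), z)`. -/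
abbrev Model (k : ℕ) : Type := ((Fin k → ℂ) × (Fin k → ℂ)) × ℂ

/-- The `ℝ`-linear isomorphism `(q, p) ↦ (1 + z z̄)⁻¹ (frame i z) (q + p J)` from `ℂ²ᵏ` to `ℍᵏ`. -/
def fiberChart {k : ℕ} (i : Fin 2) (z : ℂ) (v : (Fin k → ℂ) × (Fin k → ℂ)) : VH k :=
  fun j => ((1 + Complex.normSq z)⁻¹ : ℝ) • (frame i z * (Quaternion.coeComplex (v.1 j) + Quaternion.coeComplex (v.2 j) * qJ))

variable {k : ℕ}

/-- Translation by the lattice `L ⊆ ℂᵏ ⊆ ℍᵏ` on `ℍᵏ × P¹`. -/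
def latticeSetoid (L : Submodule ℤ (Fin k → ℂ)) : Setoid (VH k × P1) where
  r a b := ∃ γ ∈ L, b = (a.1 + fun j => Quaternion.coeComplex (γ j), a.2)
  iseqv := by
    refine ⟨fun a => ⟨0, L.zero_mem, ?_⟩, ?_, ?_⟩
    · ext1
      · funext j; simp
      · rfl
    · rintro a b ⟨γ, hγ, rfl⟩
      refine ⟨-γ, L.neg_mem hγ, ?_⟩
      ext1
      · funext j; ext <;> simp
      · rfl
    · rintro a b c ⟨γ, hγ, rfl⟩ ⟨δ, hδ, rfl⟩
      refine ⟨γ + δ, L.add_mem hγ hδ, ?_⟩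
      ext1
      · funext j; simp [add_assoc]
      · rfl

/-- The twistor space `Z = (ℍᵏ × P¹) / L`. -/
def Z (L : Submodule ℤ (Fin k → ℂ)) : Type := Quotient (latticeSetoid L)

instance (L : Submodule ℤ (Fin k → ℂ)) : TopologicalSpace (Z L) :=
  inferInstanceAs (TopologicalSpace (Quotient (latticeSetoid L)))

/-- The class of `(v, x)` in the twistor space. -/
def Z.mk (L : Submodule ℤ (Fin k → ℂ)) (a : VH k × P1) : Z L := Quotient.mk (latticeSetoid L) a

/-- The projection of the twistor space to the projective line. -/
def Z.proj (L : Submodule ℤ (Fin k → ℂ)) : Z L → P1 :=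
  Quotient.lift (fun a : VH k × P1 => a.2) (by rintro a b ⟨γ, _, rfl⟩; rfl)

/-- The twistor line `l_v`. -/
def twistorLine (L : Submodule ℤ (Fin k → ℂ)) (v : VH k) (x : P1) : Z L := Z.mk L (v, x)

/-- The holomorphic parametrizations of the twistor space. -/
def Z.param (L : Submodule ℤ (Fin k → ℂ)) (i : Fin 2) (a : Model k) : Z L :=
  Z.mk L (fiberChart i a.2 a.1, P1.psi i a.2)

section

variable (L : Submodule ℤ (Fin k → ℂ)) [ChartedSpace (Model k) (Z L)]
  [IsManifold 𝓘(ℂ, Model k) ω (Z L)]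

/-- The (real) differential at `v` of the parametrization `v ↦ [(v, x)]` of the fiber over `x` by
`ℍᵏ`. -/
def fiberDeriv (v : VH k) (x : P1) (a : VH k) : TangentSpace 𝓘(ℂ, Model k) (Z.mk L (v, x)) :=
  (mfderiv 𝓘(ℝ, VH k) 𝓘(ℝ, Model k) (fun w => Z.mk L (w, x)) v : VH k →L[ℝ] Model k) a

/-- The complex structure of the twistor space is the one given by the parametrizations
`F⁽¹⁾`, `F⁽²⁾` followed by the quotient map. -/
def HasTwistorComplexStructure : Prop :=
  ∀ i : Fin 2, IsLocalDiffeomorph 𝓘(ℂ, Model k) 𝓘(ℂ, Model k) ω (Z.param L i)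

/-- As a real manifold the twistor space is the product of `ℍᵏ / L` and `P¹`: the quotient map from
the smooth product `ℍᵏ × P¹` is a local diffeomorphism. -/
def IsSmoothQuotientOfProduct : Prop :=
  IsLocalDiffeomorph (𝓘(ℝ, VH k).prod 𝓘(ℝ, ℂ)) 𝓘(ℝ, Model k) ∞ (Z.mk L)

/-- The fiber over `P1.psi i z` is `ℍᵏ / L` with complex structure the left multiplication by
the imaginary unit quaternion `rotate i z I`. -/
def HasTwistorFibers : Prop :=
  ∀ (i : Fin 2) (z : ℂ) (v : VH k),
    MDifferentiableAt 𝓘(ℝ, VH k) 𝓘(ℝ, Model k) (fun w => Z.mk L (w, P1.psi i z)) v ∧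
    Function.Injective (fiberDeriv L v (P1.psi i z)) ∧
    range (fiberDeriv L v (P1.psi i z)) =
      (Vert (E := Model k) (Z.proj L) (Z.mk L (v, P1.psi i z)) : Set _) ∧
    ∀ a : VH k, fiberDeriv L v (P1.psi i z) (rotate i z qI • a) =
      Complex.I • fiberDeriv L v (P1.psi i z) a

variable {L} in
/-- In the `i`-th trivialization of `𝒪(2)`, the form `Ω` is `Ω⁽ⁱ⁾_z` on the fiber over
`P1.psi i z`. -/
def IsTwistorForm (Ω : RelForm (E := Model k) (Z.proj L)) : Prop :=
  ∀ (i : Fin 2) (z : ℂ) (v : VH k) (a b : VH k)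
    (X Y : Vert (E := Model k) (Z.proj L) (Z.mk L (v, P1.psi i z))),
    (X : TangentSpace 𝓘(ℂ, Model k) (Z.mk L (v, P1.psi i z))) =
      fiberDeriv L v (P1.psi i z) a →
    (Y : TangentSpace 𝓘(ℂ, Model k) (Z.mk L (v, P1.psi i z))) =
      fiberDeriv L v (P1.psi i z) b →
    fiberCoord 2 i ⟨_, Ω (Z.mk L (v, P1.psi i z)) ![X, Y]⟩ = stdForm i z a b

end

end HKTwistor

end

/-! Write `h` for `frame i z`. Since `h⁻¹ = h̄ / (1 + z z̄)`, the inverse of the fiber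
parametrization `u ↦ (1 + z z̄)⁻¹ h u` is `v ↦ h̄ v`. In complex coordinates this is `lineCoord i z
v = alpha • v + beta • (-K v)`, with `(alpha, beta)` equal to `(1, ζ)` or `(ξ, 1)`. So a constant
vector `v` becomes an affine function of `z`, homogeneous of degree one in the homogeneous
coordinates of the line, i.e. a holomorphic section of `ℂ²ᵏ ⊗ 𝒪(1)`. Hence `ℍᵏ × P¹` is the total
space of `ℂ²ᵏ ⊗ 𝒪(1)`, and `L` acts by adding holomorphic sections. The coordinate changes of the
quotient are the holomorphic maps `transition`; on vertical vectors their differential is the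
cocycle of `𝒪(1)`, because the translation part drops out (`fderiv_transition_vertical`).

The remaining claims follow from this. Conjugation by `h` turns left multiplication by `h I h⁻¹`
into multiplication by `i` (`lineCoord_rotate_smul`) and turns `(1 + z z̄) Ω_{(J,K)}` into the
constant form `∑ dq ∧ dp` (`stdForm_eq`). That form is quadratic, so the cocycle of `𝒪(1)`
multiplies it by its square, the cocycle of `𝒪(2)`; this gives a holomorphic relative form, closed
on fibers because its coefficients are constant there. A twistor line is an affine curve in the
charts, and projecting along its tangent identifies its normal bundle with the vertical bundle,
hence with `ℂ²ᵏ ⊗ 𝒪(1)`. The real structure is `(v, x) ↦ (v, α x)`. In the charts it is the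
anti-linear map `flipL`, left multiplication by `∓K` on the fiber coordinates, which sends `∑ dq ∧
dp` to minus its conjugate (`lineCoord_antipodal`, `sympl_flip`).

Tangent spaces are identified with `Model k` by the preferred chart at each point. Smoothness
statements therefore compare the preferred chart at a nearby point with the one at the base point;
`tangentCoord` and `pointCocycle` record this comparison. -/

noncomputable section

namespace HKTwistor

/-! ## Linear algebra of the fibers -/

/-- The complex coordinates `(q, p)` of `q + p J`. -/
abbrev FiberModel (k : ℕ) : Type := (Fin k → ℂ) × (Fin k → ℂ)

variable {k : ℕ}

/-- The complex coordinates `(a, b)` of a vector `a + b J` of `ℍᵏ`. -/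
def splitL : VH k →L[ℝ] FiberModel k :=
  LinearMap.toContinuousLinearMap
    { toFun := fun v => (fun j => ⟨(v j).re, (v j).imI⟩, fun j => ⟨(v j).imJ, (v j).imK⟩)
      map_add' := fun v w => by ext j <;> rfl
      map_smul' := fun c v => by ext j <;> simp [Complex.ext_iff] }

/-- The map `a + b J ↦ (I b̄, -I ā)`, i.e. the coordinates of `-K v`. -/
def splitKL : VH k →L[ℝ] FiberModel k :=
  LinearMap.toContinuousLinearMap
    { toFun := fun v => (fun j => ⟨(v j).imK, (v j).imJ⟩, fun j => ⟨-(v j).imI, -(v j).re⟩)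
      map_add' := fun v w => by
        ext j <;> simp [Complex.ext_iff, add_comm]
      map_smul' := fun c v => by ext j <;> simp [Complex.ext_iff] }

/-- The first homogeneous coefficient of a twistor line. -/
def alpha (i : Fin 2) (z : ℂ) : ℂ := if i = 0 then 1 else z

/-- The second homogeneous coefficient of a twistor line. -/
def beta (i : Fin 2) (z : ℂ) : ℂ := if i = 0 then z else 1

/-- The fiber coordinates over `P1.psi i z` of the twistor line through `v`. -/
def lineCoord (i : Fin 2) (z : ℂ) (v : VH k) : FiberModel k :=
  alpha i z • splitL v + beta i z • splitKL v

theorem lineCoord_fst (i : Fin 2) (z : ℂ) (v : VH k) (j : Fin k) :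
    (lineCoord i z v).1 j = alpha i z * ⟨(v j).re, (v j).imI⟩ + beta i z * ⟨(v j).imK, (v j).imJ⟩ :=
  rfl

theorem lineCoord_snd (i : Fin 2) (z : ℂ) (v : VH k) (j : Fin k) :
    (lineCoord i z v).2 j =
      alpha i z * ⟨(v j).imJ, (v j).imK⟩ + beta i z * ⟨-(v j).imI, -(v j).re⟩ :=
  rfl

theorem lineCoord_add (i : Fin 2) (z : ℂ) (v w : VH k) :
    lineCoord i z (v + w) = lineCoord i z v + lineCoord i z w := by
  simp only [lineCoord, map_add, smul_add]; abel

theorem one_add_normSq_pos (z : ℂ) : 0 < 1 + Complex.normSq z := by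
  have := Complex.normSq_nonneg z; linarith

@[simp] theorem qI_components : qI.re = 0 ∧ qI.imI = 1 ∧ qI.imJ = 0 ∧ qI.imK = 0 :=
  ⟨rfl, rfl, rfl, rfl⟩

@[simp] theorem qJ_components : qJ.re = 0 ∧ qJ.imI = 0 ∧ qJ.imJ = 1 ∧ qJ.imK = 0 :=
  ⟨rfl, rfl, rfl, rfl⟩

@[simp] theorem qK_components : qK.re = 0 ∧ qK.imI = 0 ∧ qK.imJ = 0 ∧ qK.imK = 1 :=
  ⟨rfl, rfl, rfl, rfl⟩

theorem frame_zero_components (z : ℂ) :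
    (frame 0 z).re = 1 ∧ (frame 0 z).imI = 0 ∧ (frame 0 z).imJ = -z.im ∧
      (frame 0 z).imK = z.re := by
  simp [frame]

theorem frame_one_components (z : ℂ) :
    (frame 1 z).re = z.re ∧ (frame 1 z).imI = -z.im ∧ (frame 1 z).imJ = 0 ∧
      (frame 1 z).imK = 1 := by
  simp [frame]

/-- `lineCoord i z v` is the vector `h̄ v` in complex coordinates, and `h̄ h = 1 + z z̄` cancels the
normalizing factor of `fiberChart`. -/
theorem lineCoord_fiberChart (i : Fin 2) (z : ℂ) (u : FiberModel k) :
    lineCoord i z (fiberChart i z u) = u := by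
  have h := (one_add_normSq_pos z).ne'
  rw [Complex.normSq_apply] at h
  fin_cases i <;> ext j <;>
  simp [lineCoord_fst, lineCoord_snd, fiberChart, frame_zero_components, frame_one_components,
    alpha, beta, Complex.ext_iff, Complex.normSq_apply] <;> constructor <;> field_simp <;> ring

theorem fiberChart_lineCoord (i : Fin 2) (z : ℂ) (v : VH k) :
    fiberChart i z (lineCoord i z v) = v := by
  have h := (one_add_normSq_pos z).ne'
  rw [Complex.normSq_apply] at h
  fin_cases i <;> funext j <;> ext <;>
  simp [lineCoord_fst, lineCoord_snd, fiberChart, frame_zero_components, frame_one_components,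
    alpha, beta, Complex.normSq_apply] <;> field_simp <;> ring

/-! ### Rotated units, the symplectic form and the antipodal map in fiber coordinates. -/

theorem normSq_frame (i : Fin 2) (z : ℂ) :
    Quaternion.normSq (frame i z) = 1 + Complex.normSq z := by
  fin_cases i <;> simp [Quaternion.normSq_def', frame_zero_components, frame_one_components,
    Complex.normSq_apply] <;> ring

theorem rotate_eq (i : Fin 2) (z : ℂ) (u : ℍ[ℝ]) :
    rotate i z u = (1 + Complex.normSq z)⁻¹ • (frame i z * u * star (frame i z)) := by
  rw [rotate, Quaternion.inv_def, normSq_frame, mul_smul_comm]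

/-- In quaternions this is `h̄ (h I h⁻¹) v = I h̄ v`, since `h̄` is a real multiple of `h⁻¹`. -/
theorem lineCoord_rotate_smul (i : Fin 2) (z : ℂ) (v : VH k) :
    lineCoord i z (rotate i z qI • v) = Complex.I • lineCoord i z v := by
  have h := (one_add_normSq_pos z).ne'
  rw [Complex.normSq_apply] at h
  rw [rotate_eq]
  fin_cases i <;> ext j <;>
  simp [lineCoord_fst, lineCoord_snd, frame_zero_components, frame_one_components, alpha, beta,
    Complex.ext_iff, Complex.normSq_apply] <;> constructor <;> field_simp <;> ring

/-- The standard complex symplectic form of `ℂ²ᵏ`. -/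
def sympl (u w : FiberModel k) : ℂ := ∑ j, (u.1 j * w.2 j - u.2 j * w.1 j)

/-- Left multiplication by `h̄` scales the metric by `1 + z z̄`, so `(1 + z z̄) g(h u h⁻¹ a, b) =
g(u h̄ a, h̄ b)`; for `u = J, K` this is the standard symplectic form in the coordinates of `h̄ a`
and `h̄ b`. -/
theorem complexForm_component (i : Fin 2) (z : ℂ) (a b : VH k) (j : Fin k) :
    (1 + z * conj z) *
      ((((rotate i z qJ • a) j * star (b j)).re : ℂ) +
        Complex.I * (((rotate i z qK • a) j * star (b j)).re : ℂ)) =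
      (lineCoord i z a).1 j * (lineCoord i z b).2 j -
        (lineCoord i z a).2 j * (lineCoord i z b).1 j := by
  have h := (one_add_normSq_pos z).ne'
  rw [Complex.normSq_apply] at h
  rw [rotate_eq, rotate_eq, lineCoord_fst, lineCoord_fst, lineCoord_snd, lineCoord_snd,
    Complex.mul_conj, Pi.smul_apply, Pi.smul_apply]
  generalize a j = x, b j = y
  fin_cases i <;>
  simp [frame_zero_components, frame_one_components, alpha, beta,
    Complex.ext_iff, Complex.normSq_apply] <;> constructor <;> field_simp <;> ring

theorem stdForm_eq (i : Fin 2) (z : ℂ) (a b : VH k) :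
    stdForm i z a b = sympl (lineCoord i z a) (lineCoord i z b) := by
  simp only [stdForm, complexForm, kahlerForm, metric, sympl, ← complexForm_component,
    ← Finset.mul_sum, Finset.sum_add_distrib, Complex.ofReal_sum]

/-- Homogeneity of degree one: this is the gluing rule for sections of `𝒪(1)`. -/
theorem lineCoord_inv (i : Fin 2) {z : ℂ} (hz : z ≠ 0) (v : VH k) :
    lineCoord (1 - i) z⁻¹ v = z⁻¹ • lineCoord i z v := by
  fin_cases i <;> simp [lineCoord, alpha, beta, smul_smul, hz]

/-- The constant `± I` in the formula for the antipodal map. -/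
def flipUnit (i : Fin 2) : ℂ := if i = 0 then Complex.I else -Complex.I

theorem flipUnit_mul_self (i : Fin 2) : flipUnit i * flipUnit i = -1 := by
  fin_cases i <;> simp [flipUnit]

/-- The anti-linear map of fiber coordinates induced by the antipodal map. -/
def flip (i : Fin 2) : FiberModel k →L[ℝ] FiberModel k :=
  LinearMap.toContinuousLinearMap
    { toFun := fun u => (flipUnit i • star u.2, -flipUnit i • star u.1)
      map_add' := fun u w => by ext j <;> simp [mul_add]
      map_smul' := fun c u => by ext j <;> simp [mul_left_comm] }

theorem flip_apply (i : Fin 2) (u : FiberModel k) :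
    flip i u = (flipUnit i • star u.2, -flipUnit i • star u.1) := rfl

theorem flip_I_smul (i : Fin 2) (u : FiberModel k) :
    flip i (Complex.I • u) = -(Complex.I • flip i u) := by
  rw [flip_apply, flip_apply]
  ext j <;> simp [mul_left_comm]

/-- Swapping `q` and `p` with opposite signs preserves the form; the minus sign comes from `(±I)² =
-1`. -/
theorem sympl_flip (i : Fin 2) (u w : FiberModel k) :
    sympl (flip i u) (flip i w) = -conj (sympl u w) := by
  simp only [sympl, map_sum, ← Finset.sum_neg_distrib]
  refine Finset.sum_congr rfl fun j _ => ?_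
  simp [flip_apply]
  linear_combination
    (conj (u.1 j) * conj (w.2 j) - conj (u.2 j) * conj (w.1 j)) * flipUnit_mul_self i

/-- `flip` is left multiplication by `-K` for `i = 0` and by `K` for `i = 1`. The identity then
follows from `K z = z̄ K` and `K² = -1`. -/
theorem lineCoord_antipodal (i : Fin 2) (z : ℂ) (v : VH k) :
    lineCoord (1 - i) (-conj z) v = flip i (lineCoord i z v) := by
  fin_cases i <;> ext j <;>
  simp [flip_apply, flipUnit, lineCoord_fst, lineCoord_snd, alpha, beta, Complex.ext_iff] <;>
  (try constructor) <;> ring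

theorem sympl_smul_smul (c : ℂ) (u w : FiberModel k) :
    sympl (c • u) (c • w) = c ^ 2 * sympl u w := by
  simp only [sympl, Finset.mul_sum]
  refine Finset.sum_congr rfl fun j _ => ?_
  simp; ring

theorem sympl_add_left (u u' w : FiberModel k) : sympl (u + u') w = sympl u w + sympl u' w := by
  simp only [sympl, ← Finset.sum_add_distrib]
  refine Finset.sum_congr rfl fun j _ => ?_
  simp; ring

theorem sympl_smul_left (c : ℂ) (u w : FiberModel k) : sympl (c • u) w = c * sympl u w := by
  simp only [sympl, Finset.mul_sum]
  refine Finset.sum_congr rfl fun j _ => ?_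
  simp; ring

theorem sympl_self (u : FiberModel k) : sympl u u = 0 :=
  Finset.sum_eq_zero fun j _ => by ring

theorem sympl_swap (u w : FiberModel k) : sympl w u = -sympl u w := by
  simp only [sympl, ← Finset.sum_neg_distrib]
  refine Finset.sum_congr rfl fun j _ => ?_
  ring

theorem sympl_nondegenerate {u : FiberModel k} (h : ∀ w, sympl u w = 0) : u = 0 := by
  ext j
  · simpa [sympl, Pi.single_apply] using h (0, Pi.single j 1)
  · simpa [sympl, Pi.single_apply] using h (Pi.single j 1, 0)


/-! ## Topology of the projective line -/

namespace P1

theorem mk_eq_mk_iff {v w : Fin 2 → ℂ} (hv : v ≠ 0) (hw : w ≠ 0) :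
    mk v hv = mk w hw ↔ v 0 * w 1 = v 1 * w 0 := by
  refine (Projectivization.mk_eq_mk_iff' ℂ _ _ hv hw).trans ⟨?_, fun h => ?_⟩
  · rintro ⟨a, rfl⟩
    simp only [Pi.smul_apply, smul_eq_mul]; ring
  · by_cases h0 : w 0 = 0
    · have h1 : w 1 ≠ 0 := fun h1 => hw (by ext j; fin_cases j <;> assumption)
      refine ⟨v 1 / w 1, ?_⟩
      have : v 0 = 0 := by simpa [h0, h1] using h
      ext j; fin_cases j
      · simp [h0, this]
      · simp [h1]
    · refine ⟨v 0 / w 0, ?_⟩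
      ext j; fin_cases j
      · simp [h0]
      · simp only [Fin.mk_one, Pi.smul_apply, smul_eq_mul]
        rw [div_mul_eq_mul_div, h, mul_div_cancel_right₀ _ h0]

theorem isOpenQuotientMap_mk :
    IsOpenQuotientMap (fun v : {v : Fin 2 → ℂ // v ≠ 0} => mk v.1 v.2) := by
  refine IsOpenQuotientMap.iff_isOpenMap_isQuotientMap.2 ⟨fun U hU => ?_, isQuotientMap_mk⟩
  rw [← isQuotientMap_mk.isOpen_preimage]
  have h : (fun v : {v : Fin 2 → ℂ // v ≠ 0} => mk v.1 v.2) ⁻¹' ((fun v => mk v.1 v.2) '' U) =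
      ⋃ t : ℂˣ, (fun v : {v : Fin 2 → ℂ // v ≠ 0} =>
        (⟨t • v.1, (smul_ne_zero_iff_ne t).2 v.2⟩ : {v : Fin 2 → ℂ // v ≠ 0})) ⁻¹' U := by
    ext v
    simp only [mem_preimage, mem_image, mem_iUnion]
    constructor
    · rintro ⟨w, hw, h⟩
      obtain ⟨t, ht⟩ := (Projectivization.mk_eq_mk_iff ℂ _ _ w.2 v.2).1 h
      exact ⟨t, by simpa only [ht] using hw⟩
    · rintro ⟨t, ht⟩
      exact ⟨_, ht, (Projectivization.mk_eq_mk_iff ℂ _ _ _ v.2).2 ⟨t, rfl⟩⟩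
  rw [h]
  refine isOpen_iUnion fun t => hU.preimage ?_
  exact (continuous_subtype_val.const_smul t).subtype_mk _

instance : T2Space P1 := by
  rw [t2Space_iff_of_isOpenQuotientMap isOpenQuotientMap_mk]
  simp only [mk_eq_mk_iff]
  have hc (j : Fin 2) : Continuous fun v : {v : Fin 2 → ℂ // v ≠ 0} => v.1 j :=
    (continuous_apply j).comp continuous_subtype_val
  exact isClosed_eq (((hc 0).comp continuous_fst).mul ((hc 1).comp continuous_snd))
    (((hc 1).comp continuous_fst).mul ((hc 0).comp continuous_snd))

instance : SecondCountableTopology P1 :=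
  isOpenQuotientMap_mk.isQuotientMap.secondCountableTopology isOpenQuotientMap_mk.isOpenMap

theorem psi_mem_patch_iff (i j : Fin 2) (z : ℂ) : psi i z ∈ patch j ↔ i = j ∨ z ≠ 0 := by
  fin_cases i <;> fin_cases j <;> simp [psi]

theorem psi_inv (i : Fin 2) {z : ℂ} (hz : z ≠ 0) : psi (1 - i) z⁻¹ = psi i z := by
  fin_cases i <;> simp [psi, mk_eq_mk_iff, hz]

end P1

/-! ## Topology of the twistor space -/

/-- The inclusion of `ℂᵏ` in `ℍᵏ`. -/
def toVH (γ : Fin k → ℂ) : VH k := fun j => Quaternion.coeComplex (γ j)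

theorem continuous_toVH : Continuous (toVH (k := k)) :=
  continuous_pi fun j =>
    (Quaternion.ofComplex.toLinearMap.continuous_of_finiteDimensional).comp (continuous_apply j)

theorem splitL_toVH (γ : Fin k → ℂ) : (splitL (toVH γ)).1 = γ := rfl

namespace Z

variable (L : Submodule ℤ (Fin k → ℂ))

theorem mk_eq_mk_iff {a b : VH k × P1} :
    mk L a = mk L b ↔ ∃ γ ∈ L, b = (a.1 + toVH γ, a.2) := Quotient.eq

theorem mk_surjective : Function.Surjective (mk L) := Quotient.mk_surjective

theorem mk_add {γ : Fin k → ℂ} (hγ : γ ∈ L) (v : VH k) (x : P1) :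
    mk L (v + toVH γ, x) = mk L (v, x) := ((mk_eq_mk_iff L (a := (v, x))).2 ⟨γ, hγ, rfl⟩).symm

@[simp] theorem proj_mk (a : VH k × P1) : proj L (mk L a) = a.2 := rfl

theorem isOpenQuotientMap_mk : IsOpenQuotientMap (mk L) := by
  have hq : Topology.IsQuotientMap (mk L) := isQuotientMap_quotient_mk'
  refine IsOpenQuotientMap.iff_isOpenMap_isQuotientMap.2 ⟨fun U hU => ?_, hq⟩
  rw [← hq.isOpen_preimage]
  have h : mk L ⁻¹' (mk L '' U) =
      ⋃ γ ∈ L, (fun a : VH k × P1 => (a.1 + toVH γ, a.2)) ⁻¹' U := by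
    ext a
    simp only [mem_preimage, mem_image, mem_iUnion, exists_prop]
    constructor
    · rintro ⟨b, hb, h⟩
      obtain ⟨γ, hγ, rfl⟩ := (mk_eq_mk_iff L).1 h.symm
      exact ⟨γ, hγ, hb⟩
    · rintro ⟨γ, hγ, h⟩
      exact ⟨_, h, mk_add L hγ _ _⟩
  rw [h]
  exact isOpen_biUnion fun γ _ => hU.preimage (by fun_prop)

theorem continuous_proj : Continuous (proj L) :=
  (isOpenQuotientMap_mk L).continuous_comp_iff.1 continuous_snd

instance : SecondCountableTopology (Z L) :=
  (isOpenQuotientMap_mk L).isQuotientMap.secondCountableTopology (isOpenQuotientMap_mk L).isOpenMap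

instance [DiscreteTopology L] : T2Space (Z L) := by
  rw [t2Space_iff_of_isOpenQuotientMap (isOpenQuotientMap_mk L)]
  have hL : IsClosed (L : Set (Fin k → ℂ)) := by
    have : DiscreteTopology L.toAddSubgroup := ‹DiscreteTopology L›
    exact AddSubgroup.isClosed_of_discrete (H := L.toAddSubgroup)
  let d : (VH k × P1) × (VH k × P1) → VH k := fun p => p.2.1 - p.1.1
  have hd : Continuous d := by fun_prop
  have hd' : Continuous fun p => (splitL (d p)).1 :=
    continuous_fst.comp (splitL.continuous.comp hd)
  -- For an open quotient map, Hausdorff means that the relation is closed. Here it says that the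
  -- points of `P¹` agree and the difference of the vectors lies in `ℂᵏ` and in the closed set `L`.
  have : {p : (VH k × P1) × (VH k × P1) | mk L p.1 = mk L p.2} =
      {p | p.1.2 = p.2.2} ∩
        ({p | toVH (splitL (d p)).1 = d p} ∩ (fun p => (splitL (d p)).1) ⁻¹' L) := by
    ext ⟨⟨v, x⟩, ⟨w, y⟩⟩
    simp only [mem_ofPred_eq, mk_eq_mk_iff, mem_inter_iff, mem_preimage, SetLike.mem_coe,
      Prod.mk.injEq, d]
    constructor
    · rintro ⟨γ, hγ, rfl, rfl⟩
      simp only [add_sub_cancel_left, splitL_toVH]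
      exact ⟨trivial, trivial, hγ⟩
    · rintro ⟨rfl, h, h'⟩
      exact ⟨_, h', by rw [h]; abel, rfl⟩
  rw [this]
  refine (isClosed_eq (by fun_prop) (by fun_prop)).inter
    ((isClosed_eq (continuous_toVH.comp hd') hd).inter (hL.preimage hd'))

/-- A neighborhood `V` of `0` meets `L` only in `0`; a neighborhood `W` of the vector whose
differences have `ℂᵏ`-part in `V` contains no two distinct translates of one point. -/
theorem exists_injOn [DiscreteTopology L] (a : VH k × P1) :
    ∃ U : Set (VH k × P1), IsOpen U ∧ a ∈ U ∧ InjOn (mk L) U := by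
  obtain ⟨V, hV, hV'⟩ : ∃ V : Set (Fin k → ℂ), IsOpen V ∧
      (Subtype.val : L → Fin k → ℂ) ⁻¹' V = {0} :=
    isOpen_induced_iff.1 (isOpen_discrete ({0} : Set L))
  have hsub : Continuous fun p : VH k × VH k => (splitL (p.1 - p.2)).1 :=
    continuous_fst.comp (splitL.continuous.comp (continuous_fst.sub continuous_snd))
  have h0 : (0 : Fin k → ℂ) ∈ V := by
    have : (0 : L) ∈ (Subtype.val : L → Fin k → ℂ) ⁻¹' V := by rw [hV']; rfl
    exact this
  have hn : (fun p : VH k × VH k => (splitL (p.1 - p.2)).1) ⁻¹' V ∈ nhds (a.1, a.1) :=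
    (hV.preimage hsub).mem_nhds (by simpa using h0)
  rw [nhds_prod_eq, Filter.mem_prod_same_iff] at hn
  obtain ⟨W, hW, hWV⟩ := hn
  obtain ⟨W', hW', hW'o, haW'⟩ := mem_nhds_iff.1 hW
  refine ⟨W' ×ˢ univ, hW'o.prod isOpen_univ, ⟨haW', mem_univ _⟩, ?_⟩
  rintro ⟨v, x⟩ hv ⟨w, y⟩ hw h
  obtain ⟨γ, hγ, h'⟩ := (mk_eq_mk_iff L).1 h
  simp only [Prod.mk.injEq] at h'
  obtain ⟨rfl, rfl⟩ := h'
  have hm : γ ∈ V := by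
    have := hWV (mk_mem_prod (hW' hw.1) (hW' hv.1))
    simpa only [mem_preimage, add_sub_cancel_left, splitL_toVH] using this
  have : (⟨γ, hγ⟩ : L) ∈ (Subtype.val : L → Fin k → ℂ) ⁻¹' V := hm
  rw [hV'] at this
  have hγ0 : γ = 0 := congrArg Subtype.val (mem_singleton_iff.1 this)
  subst hγ0
  ext1
  · funext j; simp [toVH]
  · rfl

theorem mk_isLocalHomeomorph [DiscreteTopology L] : IsLocalHomeomorph (mk L) := by
  rw [isLocalHomeomorph_iff_isOpenEmbedding_restrict]
  intro a
  obtain ⟨U, hU, ha, hinj⟩ := exists_injOn L a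
  exact ⟨U, hU.mem_nhds ha, .of_continuous_injective_isOpenMap
    ((isOpenQuotientMap_mk L).continuous.comp continuous_subtype_val) hinj.injective
    ((isOpenQuotientMap_mk L).isOpenMap.domRestrict hU)⟩

end Z


/-! ## Complex manifolds as real manifolds -/

section RestrictScalars

variable {E E' : Type*} [NormedAddCommGroup E] [NormedSpace ℂ E] [NormedSpace ℝ E]
  [IsScalarTower ℝ ℂ E] [NormedAddCommGroup E'] [NormedSpace ℂ E'] [NormedSpace ℝ E']
  [IsScalarTower ℝ ℂ E'] {M M' : Type*} [TopologicalSpace M] [ChartedSpace E M]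
  [TopologicalSpace M'] [ChartedSpace E' M'] {n : WithTop ℕ∞}

theorem contMDiffWithinAt_restrictScalars {f : M → M'} {s : Set M} {x : M}
    (h : ContMDiffWithinAt 𝓘(ℂ, E) 𝓘(ℂ, E') n f s x) :
    ContMDiffWithinAt 𝓘(ℝ, E) 𝓘(ℝ, E') n f s x := by
  rw [contMDiffWithinAt_iff] at h ⊢
  exact ⟨h.1, h.2.restrict_scalars ℝ⟩

theorem contMDiffOn_restrictScalars {f : M → M'} {s : Set M}
    (h : ContMDiffOn 𝓘(ℂ, E) 𝓘(ℂ, E') n f s) : ContMDiffOn 𝓘(ℝ, E) 𝓘(ℝ, E') n f s :=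
  fun x hx => contMDiffWithinAt_restrictScalars (h x hx)

theorem hasMFDerivAt_restrictScalars {f : M → M'} {x : M} {f' : E →L[ℂ] E'}
    (h : HasMFDerivAt 𝓘(ℂ, E) 𝓘(ℂ, E') f x f') :
    HasMFDerivAt 𝓘(ℝ, E) 𝓘(ℝ, E') f x (f'.restrictScalars ℝ : E →L[ℝ] E') :=
  ⟨h.1, h.2.restrictScalars ℝ⟩

theorem isManifold_restrictScalars [IsManifold 𝓘(ℂ, E) n M] : IsManifold 𝓘(ℝ, E) n M := by
  refine isManifold_of_contDiffOn _ _ _ fun e e' he he' => ?_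
  exact ((contDiffGroupoid n 𝓘(ℂ, E)).compatible he he').1.restrict_scalars ℝ

variable (n) in
/-- A local diffeomorphism of complex manifolds is one of the underlying real manifolds. -/
theorem isLocalDiffeomorphAt_restrictScalars {f : M → M'} {x : M}
    (h : IsLocalDiffeomorphAt 𝓘(ℂ, E) 𝓘(ℂ, E') n f x) :
    IsLocalDiffeomorphAt 𝓘(ℝ, E) 𝓘(ℝ, E') n f x := by
  obtain ⟨Φ, hx, hΦ⟩ := h
  exact ⟨{ toPartialEquiv := Φ.toPartialEquiv
           open_source := Φ.open_source
           open_target := Φ.open_target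
           contMDiffOn_toFun := contMDiffOn_restrictScalars Φ.contMDiffOn_toFun
           contMDiffOn_invFun := contMDiffOn_restrictScalars Φ.contMDiffOn_invFun }, hx, hΦ⟩

end RestrictScalars

/-! ## Parametrizations of the product `ℍᵏ × P¹` -/

namespace P1

theorem contMDiffOn_coord (i : Fin 2) : ContMDiffOn 𝓘(ℂ, ℂ) 𝓘(ℂ, ℂ) ω (coord i) (patch i) :=
  contMDiffOn_of_mem_maximalAtlas (e := chart i)
    (IsManifold.subset_maximalAtlas (mem_range_self i))

theorem contMDiff_psi (i : Fin 2) : ContMDiff 𝓘(ℂ, ℂ) 𝓘(ℂ, ℂ) ω (psi i) :=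
  contMDiffOn_univ.1 (contMDiffOn_symm_of_mem_maximalAtlas (e := chart i)
    (IsManifold.subset_maximalAtlas (mem_range_self i)))

end P1

theorem contDiff_fiberChart (i : Fin 2) {n : WithTop ℕ∞} :
    ContDiff ℝ n (fun m : Model k => fiberChart i m.2 m.1) := by
  have hc : ContDiff ℝ n Quaternion.coeComplex :=
    (LinearMap.toContinuousLinearMap Quaternion.ofComplex.toLinearMap).contDiff
  have hconj : ContDiff ℝ n (fun z : ℂ => conj z) := Complex.conjCLE.contDiff
  have hf : ContDiff ℝ n (frame i) := by
    unfold frame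
    split_ifs
    · exact contDiff_const.add (hc.mul contDiff_const)
    · exact (hc.comp hconj).add contDiff_const
  have hn : ContDiff ℝ n fun z : ℂ => (1 + Complex.normSq z)⁻¹ := by
    refine ContDiff.inv (contDiff_const.add ?_) fun z => (one_add_normSq_pos z).ne'
    rw [show (⇑Complex.normSq : ℂ → ℝ) = fun z => z.re * z.re + z.im * z.im from
      funext Complex.normSq_apply]
    have h1 : ContDiff ℝ n Complex.re := Complex.reCLM.contDiff
    have h2 : ContDiff ℝ n Complex.im := Complex.imCLM.contDiff
    exact (h1.mul h1).add (h2.mul h2)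
  refine contDiff_pi.2 fun j => (hn.comp contDiff_snd).smul ((hf.comp contDiff_snd).mul
    ((hc.comp ?_).add ((hc.comp ?_).mul contDiff_const)))
  · exact (contDiff_apply ℝ ℂ j).comp (contDiff_fst.comp contDiff_fst)
  · exact (contDiff_apply ℝ ℂ j).comp (contDiff_snd.comp contDiff_fst)

theorem contDiff_alpha {𝕜 : Type*} [NontriviallyNormedField 𝕜] [NormedAlgebra 𝕜 ℂ] (i : Fin 2)
    {n : WithTop ℕ∞} : ContDiff 𝕜 n (alpha i) := by
  unfold alpha; split_ifs <;> fun_prop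

theorem contDiff_beta {𝕜 : Type*} [NontriviallyNormedField 𝕜] [NormedAlgebra 𝕜 ℂ] (i : Fin 2)
    {n : WithTop ℕ∞} : ContDiff 𝕜 n (beta i) := by
  unfold beta; split_ifs <;> fun_prop

theorem contDiff_lineCoord (i : Fin 2) {n : WithTop ℕ∞} :
    ContDiff ℝ n (fun a : VH k × ℂ => lineCoord i a.2 a.1) :=
  (((contDiff_alpha i).comp contDiff_snd).smul (splitL.contDiff.comp contDiff_fst)).add
    (((contDiff_beta i).comp contDiff_snd).smul (splitKL.contDiff.comp contDiff_fst))

/-- The smooth coordinates of `ℍᵏ × P¹` over an affine patch which induce the complex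
coordinates of the twistor space. -/
def prodChart (i : Fin 2) : PartialDiffeomorph (𝓘(ℝ, VH k).prod 𝓘(ℝ, ℂ)) 𝓘(ℝ, Model k)
    (VH k × P1) (Model k) ∞ where
  toFun a := (lineCoord i (P1.coord i a.2) a.1, P1.coord i a.2)
  invFun m := (fiberChart i m.2 m.1, P1.psi i m.2)
  source := univ ×ˢ P1.patch i
  target := univ
  map_source' _ _ := mem_univ _
  map_target' m _ := ⟨mem_univ _, P1.psi_mem i m.2⟩
  left_inv' a ha := by simp [fiberChart_lineCoord, P1.psi_coord i ha.2]
  right_inv' m _ := by simp [P1.coord_psi, lineCoord_fiberChart]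
  open_source := isOpen_univ.prod (P1.isOpen_patch i)
  open_target := isOpen_univ
  contMDiffOn_toFun := by
    have h : ContMDiffOn (𝓘(ℝ, VH k).prod 𝓘(ℝ, ℂ)) 𝓘(ℝ, ℂ) ∞
        (fun a : VH k × P1 => P1.coord i a.2) (univ ×ˢ P1.patch i) :=
      (contMDiffOn_restrictScalars ((P1.contMDiffOn_coord i).of_le le_top)).comp
        contMDiffOn_snd fun a ha => ha.2
    have h1 : ContMDiffOn (𝓘(ℝ, VH k).prod 𝓘(ℝ, ℂ)) 𝓘(ℝ, VH k × ℂ) ∞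
        (fun a : VH k × P1 => (a.1, P1.coord i a.2)) (univ ×ˢ P1.patch i) :=
      contMDiffOn_fst.prodMk_space h
    exact (((contDiff_lineCoord i).contMDiff.contMDiffOn (s := univ)).comp h1
      fun _ _ => mem_univ _).prodMk_space h
  contMDiffOn_invFun := by
    have h1 : ContMDiff 𝓘(ℝ, ℂ) 𝓘(ℝ, ℂ) ∞ (P1.psi i) :=
      contMDiffOn_univ.1 (contMDiffOn_restrictScalars
        ((P1.contMDiff_psi i).of_le le_top).contMDiffOn)
    have h2 : ContMDiff 𝓘(ℝ, Model k) 𝓘(ℝ, ℂ) ∞ (fun m : Model k => m.2) :=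
      contDiff_snd.contMDiff
    exact ((contDiff_fiberChart i).contMDiff.prodMk (h1.comp h2)).contMDiffOn

/-! ## Changes of coordinates of the twistor space -/

/-- The cocycle of `𝒪(1)` in affine coordinates. -/
def cocycle (i j : Fin 2) (z : ℂ) : ℂ := if i = j then 1 else z⁻¹

/-- The change of the affine coordinate. -/
def affineChange (i j : Fin 2) (z : ℂ) : ℂ := if i = j then z else z⁻¹

/-- The change of coordinates combined with the translation by `v`. -/
def transition (i j : Fin 2) (v : VH k) (m : Model k) : Model k :=
  (cocycle i j m.2 • m.1 + lineCoord j (affineChange i j m.2) v, affineChange i j m.2)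

theorem eq_one_sub {i j : Fin 2} (h : i ≠ j) : j = 1 - i := by
  fin_cases i <;> fin_cases j <;> simp_all

theorem psi_affineChange {i j : Fin 2} {z : ℂ} (h : P1.psi i z ∈ P1.patch j) :
    P1.psi j (affineChange i j z) = P1.psi i z := by
  rw [P1.psi_mem_patch_iff] at h
  by_cases hij : i = j
  · subst hij; simp [affineChange]
  · have hz := h.resolve_left hij
    obtain rfl := eq_one_sub hij
    rw [affineChange, if_neg hij, P1.psi_inv i hz]

theorem affineChange_eq {i j : Fin 2} {z : ℂ} (h : P1.psi i z ∈ P1.patch j) :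
    affineChange i j z = P1.coord j (P1.psi i z) := by
  rw [← psi_affineChange h, P1.coord_psi]

theorem cocycle_ne_zero {i j : Fin 2} {z : ℂ} (h : P1.psi i z ∈ P1.patch j) :
    cocycle i j z ≠ 0 := by
  rw [P1.psi_mem_patch_iff] at h
  unfold cocycle
  split_ifs with hij
  · exact one_ne_zero
  · exact inv_ne_zero (h.resolve_left hij)

theorem lineBundle_coordChange (d : ℤ) {i j : Fin 2} {z : ℂ} (h : P1.psi i z ∈ P1.patch j) (w : ℂ) :
    (lineBundle d).coordChange i j (P1.psi i z) w = cocycle i j z ^ d * w := by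
  by_cases hij : i = j
  · simp [lineBundle, cocycle, hij]
  · simp [lineBundle, cocycle, hij, ← affineChange_eq h, affineChange]

theorem lineCoord_affineChange {i j : Fin 2} {z : ℂ} (h : P1.psi i z ∈ P1.patch j) (v : VH k) :
    lineCoord j (affineChange i j z) v = cocycle i j z • lineCoord i z v := by
  rw [P1.psi_mem_patch_iff] at h
  by_cases hij : i = j
  · subst hij; simp [affineChange, cocycle]
  · have hz := h.resolve_left hij
    obtain rfl := eq_one_sub hij
    rw [affineChange, if_neg hij, cocycle, if_neg hij, lineCoord_inv i hz]

/-- Explains the form of `transition`: it is the translation `v ↦ v + w` of `ℍᵏ`, read from chart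
`i` to chart `j`. -/
theorem transition_lineCoord {i j : Fin 2} {z : ℂ} (h : P1.psi i z ∈ P1.patch j) (v w : VH k) :
    transition i j w (lineCoord i z v, z) =
      (lineCoord j (affineChange i j z) (v + w), affineChange i j z) := by
  rw [transition, lineCoord_add, lineCoord_affineChange h v]

theorem exists_eq_lineCoord (i : Fin 2) (m : Model k) : ∃ v, m = (lineCoord i m.2 v, m.2) :=
  ⟨fiberChart i m.2 m.1, by rw [lineCoord_fiberChart]⟩

theorem contDiffAt_affineChange {i j : Fin 2} {z : ℂ} (h : P1.psi i z ∈ P1.patch j) :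
    ContDiffAt ℂ ω (affineChange i j) z := by
  rw [P1.psi_mem_patch_iff] at h
  unfold affineChange
  split_ifs with hij
  · exact contDiffAt_id
  · exact contDiffAt_inv ℂ (h.resolve_left hij)

theorem contDiffAt_cocycle {i j : Fin 2} {z : ℂ} (h : P1.psi i z ∈ P1.patch j) :
    ContDiffAt ℂ ω (cocycle i j) z := by
  rw [P1.psi_mem_patch_iff] at h
  unfold cocycle
  split_ifs with hij
  · exact contDiffAt_const
  · exact contDiffAt_inv ℂ (h.resolve_left hij)

theorem contDiff_lineCoord_const (i : Fin 2) (v : VH k) :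
    ContDiff ℂ ω (fun z => lineCoord i z v) :=
  ((contDiff_alpha i).smul contDiff_const).add ((contDiff_beta i).smul contDiff_const)

theorem contDiffAt_transition {i j : Fin 2} {m : Model k} (h : P1.psi i m.2 ∈ P1.patch j)
    (v : VH k) : ContDiffAt ℂ ω (transition i j v) m := by
  have h1 : ContDiffAt ℂ ω (fun m : Model k => affineChange i j m.2) m :=
    (contDiffAt_affineChange h).comp m contDiffAt_snd
  have h2 : ContDiffAt ℂ ω (fun m : Model k => cocycle i j m.2) m :=
    (contDiffAt_cocycle h).comp m contDiffAt_snd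
  have h3 : ContDiffAt ℂ ω (fun m : Model k => m.1) m := contDiffAt_fst
  have h4 : ContDiffAt ℂ ω (fun m : Model k => lineCoord j (affineChange i j m.2) v) m :=
    (contDiff_lineCoord_const j v).contDiffAt.comp m h1
  exact ContDiffAt.prodMk (ContDiffAt.add (ContDiffAt.smul h2 h3) h4) h1

theorem fderiv_transition_vertical {i j : Fin 2} {m : Model k} (h : P1.psi i m.2 ∈ P1.patch j)
    (v : VH k) (u : FiberModel k) :
    fderiv ℂ (transition i j v) m (u, 0) = (cocycle i j m.2 • u, 0) := by
  -- On a vertical complex line the transition is affine with slope given by the cocycle, so both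
  -- derivatives at `t = 0` are compared.
  have hd := (ContDiffAt.differentiableAt (contDiffAt_transition h v) (by simp)).hasFDerivAt
  have hl : HasDerivAt (fun t : ℂ => m + t • ((u, 0) : Model k)) (u, 0) 0 := by
    simpa using HasDerivAt.const_add m ((hasDerivAt_id (0 : ℂ)).smul_const ((u, 0) : Model k))
  have h1 : HasDerivAt (fun t : ℂ => transition i j v (m + t • ((u, 0) : Model k)))
      (fderiv ℂ (transition i j v) m (u, 0)) 0 := by
    have hd' : HasFDerivAt (transition i j v) (fderiv ℂ (transition i j v) m)
        (m + (0 : ℂ) • ((u, 0) : Model k)) := by simpa using hd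
    exact hd'.comp_hasDerivAt (0 : ℂ) hl
  have h2 : HasDerivAt (fun t : ℂ => transition i j v (m + t • ((u, 0) : Model k)))
      (cocycle i j m.2 • u, 0) 0 := by
    have : (fun t : ℂ => transition i j v (m + t • ((u, 0) : Model k))) =
        fun t => transition i j v m + t • ((cocycle i j m.2 • u, 0) : Model k) := by
      funext t
      ext1
      · simp [transition, smul_comm t]; abel
      · simp [transition]
    rw [this]
    simpa using HasDerivAt.const_add (transition i j v m) ((hasDerivAt_id (0 : ℂ)).smul_const
      ((cocycle i j m.2 • u, 0) : Model k))
  exact h1.unique h2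


/-! ## The complex structure of the twistor space -/

namespace Z

variable (L : Submodule ℤ (Fin k → ℂ))

theorem param_lineCoord (i : Fin 2) (z : ℂ) (v : VH k) :
    param L i (lineCoord i z v, z) = mk L (v, P1.psi i z) := by
  rw [param, fiberChart_lineCoord]

@[simp] theorem proj_param (i : Fin 2) (m : Model k) : proj L (param L i m) = P1.psi i m.2 := rfl

theorem exists_eq_param {i : Fin 2} {z : Z L} (h : proj L z ∈ P1.patch i) :
    ∃ m, param L i m = z := by
  obtain ⟨⟨v, x⟩, rfl⟩ := mk_surjective L z
  rw [proj_mk] at h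
  exact ⟨(lineCoord i (P1.coord i x) v, P1.coord i x), by
    rw [param_lineCoord, P1.psi_coord i h]⟩

theorem param_transition {i j : Fin 2} {m : Model k} (h : P1.psi i m.2 ∈ P1.patch j)
    {γ : Fin k → ℂ} (hγ : γ ∈ L) : param L j (transition i j (toVH γ) m) = param L i m := by
  obtain ⟨v, hv⟩ := exists_eq_lineCoord i m
  rw [hv, transition_lineCoord h, param_lineCoord, param_lineCoord, psi_affineChange h,
    mk_add L hγ]

theorem exists_transition_of_param_eq {i j : Fin 2} {m m' : Model k}
    (h : param L j m' = param L i m) :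
    P1.psi i m.2 ∈ P1.patch j ∧ ∃ γ ∈ L, m' = transition i j (toVH γ) m := by
  obtain ⟨v, hv⟩ := exists_eq_lineCoord i m
  obtain ⟨v', hv'⟩ := exists_eq_lineCoord j m'
  have hp : P1.psi i m.2 ∈ P1.patch j := by
    rw [← proj_param L, ← h]
    exact P1.psi_mem j m'.2
  refine ⟨hp, ?_⟩
  rw [hv, hv', param_lineCoord, param_lineCoord] at h
  obtain ⟨γ, hγ, h'⟩ := (mk_eq_mk_iff L).1 h.symm
  simp only [Prod.mk.injEq] at h'
  refine ⟨γ, hγ, ?_⟩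
  have hz : m'.2 = affineChange i j m.2 := by
    rw [affineChange_eq hp, ← h'.2, P1.coord_psi]
  rw [hv, transition_lineCoord hp, ← h'.1, ← hz, hv']

variable {L} in
/-- In the given coordinates a parametrization is locally a change of coordinates. -/
theorem chart_comp_param_eventuallyEq {e : OpenPartialHomeomorph (Z L) (Model k)} {j : Fin 2}
    (he : ⇑e.symm = param L j) {i : Fin 2} {m : Model k} (hm : param L i m ∈ e.source) :
    P1.psi i m.2 ∈ P1.patch j ∧ ∃ γ ∈ L, e ∘ param L i =ᶠ[nhds m] transition i j (toVH γ) := by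
  have h : param L j (e (param L i m)) = param L i m := by rw [← he, e.left_inv hm]
  obtain ⟨hp, γ, hγ, hm'⟩ := exists_transition_of_param_eq L h
  refine ⟨hp, γ, hγ, ?_⟩
  -- The `γ` found at `m` works nearby: the transition stays in `e.target` by continuity, and there
  -- `e` inverts `param L j`.
  have hc : ContinuousAt (transition i j (toVH γ)) m :=
    (contDiffAt_transition hp (toVH γ)).continuousAt
  have h1 : ∀ᶠ m₁ in nhds m, transition i j (toVH γ) m₁ ∈ e.target :=
    hc.eventually_mem (e.open_target.mem_nhds (hm' ▸ e.map_source hm))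
  have h2 : ∀ᶠ m₁ in nhds m, P1.psi i m₁.2 ∈ P1.patch j :=
    ((P1.continuous_psi i).comp continuous_snd).continuousAt.eventually_mem
      ((P1.isOpen_patch j).mem_nhds hp)
  filter_upwards [h1, h2] with m₁ hm₁ hm₂
  rw [Function.comp_apply, ← param_transition L hm₂ hγ, ← he, e.right_inv hm₁]

variable [DiscreteTopology L]

theorem param_isLocalHomeomorph (i : Fin 2) : IsLocalHomeomorph (param L i) := by
  refine (mk_isLocalHomeomorph L).comp fun m => ?_
  exact ⟨(prodChart i).toOpenPartialHomeomorph.symm, mem_univ _, rfl⟩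

/-- A coordinate system of the twistor space around a given point. -/
theorem exists_chart (z : Z L) : ∃ e : OpenPartialHomeomorph (Z L) (Model k),
    z ∈ e.source ∧ ⇑e.symm = param L (P1.index (proj L z)) := by
  obtain ⟨m, hm⟩ := exists_eq_param L (P1.mem_patch_index (proj L z))
  obtain ⟨e, he, h⟩ := param_isLocalHomeomorph L (P1.index (proj L z)) m
  refine ⟨e.symm, ?_, h.symm⟩
  rw [← hm, h]
  exact e.map_source he

/-- The inverse of a chart is required to equal some `param L i` as a total function, so coordinate
changes can be computed from `param` alone. -/
instance : ChartedSpace (Model k) (Z L) where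
  atlas := {e | ∃ i, ⇑e.symm = param L i}
  chartAt z := (exists_chart L z).choose
  mem_chart_source z := (exists_chart L z).choose_spec.1
  chart_mem_atlas z := ⟨_, (exists_chart L z).choose_spec.2⟩

variable {L} in
theorem chartAt_symm (z : Z L) : ⇑(chartAt (Model k) z).symm = param L (P1.index (proj L z)) :=
  (exists_chart L z).choose_spec.2

instance : IsManifold 𝓘(ℂ, Model k) ω (Z L) := by
  refine isManifold_of_contDiffOn _ _ _ ?_
  rintro e e' ⟨i, hi⟩ ⟨j, hj⟩
  simp only [modelWithCornersSelf_coe, modelWithCornersSelf_coe_symm, Function.comp_id,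
    Function.id_comp, preimage_id, range_id, inter_univ]
  intro m hm
  rw [OpenPartialHomeomorph.trans_source, e.symm_source, mem_inter_iff, mem_preimage, hi] at hm
  obtain ⟨hp, γ, _, h⟩ := chart_comp_param_eventuallyEq hj hm.2
  rw [OpenPartialHomeomorph.coe_trans, hi]
  exact ((contDiffAt_transition hp (toVH γ)).congr_of_eventuallyEq h).contDiffWithinAt

instance : IsManifold 𝓘(ℝ, Model k) ω (Z L) := isManifold_restrictScalars

theorem hasTwistorComplexStructure : HasTwistorComplexStructure L := by
  intro i m
  obtain ⟨e, he, h⟩ := param_isLocalHomeomorph L i m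
  have hmem : e.symm ∈ IsManifold.maximalAtlas 𝓘(ℂ, Model k) ω (Z L) :=
    IsManifold.subset_maximalAtlas ⟨i, h.symm⟩
  exact ⟨{ toPartialEquiv := e.toPartialEquiv
           open_source := e.open_source
           open_target := e.open_target
           contMDiffOn_toFun := contMDiffOn_symm_of_mem_maximalAtlas hmem
           contMDiffOn_invFun := contMDiffOn_of_mem_maximalAtlas hmem },
    he, fun _ _ => by rw [h]; rfl⟩

theorem isSmoothQuotientOfProduct : IsSmoothQuotientOfProduct L := by
  rintro ⟨v, x⟩
  -- The quotient map factors locally as `param ∘ prodChart`.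
  obtain ⟨Φ, hΦ, h⟩ := isLocalDiffeomorphAt_restrictScalars ω
    (hasTwistorComplexStructure L (P1.index x) (prodChart (P1.index x) (v, x)))
  let Φ' : PartialDiffeomorph 𝓘(ℝ, Model k) 𝓘(ℝ, Model k) (Model k) (Z L) ∞ :=
    { toPartialEquiv := Φ.toPartialEquiv
      open_source := Φ.open_source
      open_target := Φ.open_target
      contMDiffOn_toFun := Φ.contMDiffOn_toFun.of_le le_top
      contMDiffOn_invFun := Φ.contMDiffOn_invFun.of_le le_top }
  refine ⟨(prodChart (P1.index x)).trans Φ', ⟨⟨mem_univ _, P1.mem_patch_index x⟩, hΦ⟩, ?_⟩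
  rintro ⟨w, y⟩ ⟨hy, hy'⟩
  have h1 : param L (P1.index x) (prodChart (P1.index x) (w, y)) =
      Φ (prodChart (P1.index x) (w, y)) :=
    h hy'
  have h2 : param L (P1.index x) (prodChart (P1.index x) (w, y)) =
      mk L (w, P1.psi _ (P1.coord (P1.index x) y)) :=
    param_lineCoord L _ _ _
  rw [P1.psi_coord _ hy.2] at h2
  exact h2.symm.trans h1

end Z


/-! ## Tangent vectors of the twistor space -/

/-- The coordinates of twistor lines as a linear map. -/
def lineCoordL (i : Fin 2) (z : ℂ) : VH k →L[ℝ] FiberModel k :=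
  alpha i z • splitL + beta i z • splitKL

namespace Z

variable {L : Submodule ℤ (Fin k → ℂ)}

theorem fderiv_chart_comp_param {e : OpenPartialHomeomorph (Z L) (Model k)} {j : Fin 2}
    (he : ⇑e.symm = param L j) {i : Fin 2} {m : Model k} (hm : param L i m ∈ e.source)
    (u : FiberModel k) :
    fderiv ℂ (e ∘ param L i) m (u, 0) = (cocycle i j m.2 • u, 0) := by
  obtain ⟨hp, γ, _, h⟩ := chart_comp_param_eventuallyEq he hm
  rw [h.fderiv_eq, fderiv_transition_vertical hp]

theorem differentiableAt_chart_comp_param {e : OpenPartialHomeomorph (Z L) (Model k)} {j : Fin 2}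
    (he : ⇑e.symm = param L j) {i : Fin 2} {m : Model k} (hm : param L i m ∈ e.source) :
    DifferentiableAt ℂ (e ∘ param L i) m := by
  obtain ⟨hp, γ, _, h⟩ := chart_comp_param_eventuallyEq he hm
  exact h.differentiableAt_iff.2
    (ContDiffAt.differentiableAt (contDiffAt_transition hp _) (by simp))

variable [DiscreteTopology L]

theorem proj_chartAt_symm (z : Z L) (m : Model k) :
    proj L ((chartAt (Model k) z).symm m) = P1.psi (P1.index (proj L z)) m.2 := by
  rw [chartAt_symm, proj_param]

theorem psi_chartAt {z₀ z : Z L} (h : z ∈ (chartAt (Model k) z₀).source) :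
    P1.psi (P1.index (proj L z₀)) (chartAt (Model k) z₀ z).2 = proj L z := by
  rw [← proj_chartAt_symm, (chartAt (Model k) z₀).left_inv h]

theorem contMDiff_proj : ContMDiff 𝓘(ℂ, Model k) 𝓘(ℂ, ℂ) ω (proj L) := by
  intro z
  have h1 : ContMDiffAt 𝓘(ℂ, Model k) 𝓘(ℂ, ℂ) ω
      (fun y => P1.psi (P1.index (proj L z)) (chartAt (Model k) z y).2) z := by
    have h2 : ContMDiff 𝓘(ℂ, Model k) 𝓘(ℂ, ℂ) ω (fun m : Model k => m.2) :=
      contDiff_snd.contMDiff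
    have h3 : ContMDiffAt 𝓘(ℂ, Model k) 𝓘(ℂ, Model k) ω (chartAt (Model k) z) z :=
      contMDiffAt_of_mem_maximalAtlas (IsManifold.chart_mem_maximalAtlas z)
        (mem_chart_source (Model k) z)
    exact (P1.contMDiff_psi _).contMDiffAt.comp z (h2.contMDiffAt.comp z h3)
  refine h1.congr_of_eventuallyEq ?_
  filter_upwards [(chartAt (Model k) z).open_source.mem_nhds (mem_chart_source (Model k) z)]
    with y hy
  exact (psi_chartAt hy).symm

theorem hasMFDerivAt_proj (z : Z L) :
    HasMFDerivAt 𝓘(ℂ, Model k) 𝓘(ℂ, ℂ) (proj L) z (ContinuousLinearMap.snd ℂ (FiberModel k) ℂ) := by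
  refine ⟨(continuous_proj L).continuousAt, ?_⟩
  -- The preferred charts at `z` and at its projection use the same affine patch, so the projection
  -- is exactly the second coordinate.
  have h : writtenInExtChartAt 𝓘(ℂ, Model k) 𝓘(ℂ, ℂ) z (proj L) = Prod.snd := by
    funext m
    change P1.coord (P1.index (proj L z)) (proj L ((chartAt (Model k) z).symm m)) = m.2
    rw [proj_chartAt_symm, P1.coord_psi]
  rw [h]
  exact hasFDerivAt_snd.hasFDerivWithinAt

theorem mem_vert_iff {z : Z L} {X : TangentSpace 𝓘(ℂ, Model k) z} :
    X ∈ Vert (E := Model k) (proj L) z ↔ (X : Model k).2 = 0 := by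
  rw [Vert, LinearMap.mem_ker, (hasMFDerivAt_proj z).mfderiv]
  rfl

theorem isHolomorphicFibration : IsHolomorphicFibration (E := Model k) (proj L) := by
  refine ⟨contMDiff_proj, fun x => ⟨mk L (0, x), rfl⟩, fun z => ?_⟩
  rw [(hasMFDerivAt_proj z).mfderiv]
  exact fun t => ⟨((0, t) : Model k), rfl⟩

theorem hasMFDerivAt_param (i : Fin 2) (m : Model k) :
    HasMFDerivAt 𝓘(ℂ, Model k) 𝓘(ℂ, Model k) (param L i) m
      (fderiv ℂ (chartAt (Model k) (param L i m) ∘ param L i) m) := by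
  refine ⟨(hasTwistorComplexStructure L i).contMDiff.continuous.continuousAt, ?_⟩
  have hs := mem_chart_source (Model k) (param L i m)
  exact (differentiableAt_chart_comp_param (chartAt_symm _) hs).hasFDerivAt.hasFDerivWithinAt

theorem hasMFDerivAt_fiber (i : Fin 2) (z : ℂ) (v : VH k) :
    HasMFDerivAt 𝓘(ℝ, VH k) 𝓘(ℝ, Model k) (fun w => mk L (w, P1.psi i z)) v
      (((ContinuousLinearMap.inl ℝ (FiberModel k) ℂ).comp
        (cocycle i (P1.index (P1.psi i z)) z • lineCoordL i z) : VH k →L[ℝ] Model k)) := by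
  have h1 : HasMFDerivAt 𝓘(ℝ, VH k) 𝓘(ℝ, Model k) (fun w : VH k => (lineCoord i z w, z)) v
      ((lineCoordL i z).prod (0 : VH k →L[ℝ] ℂ) : VH k →L[ℝ] Model k) :=
    ((lineCoordL i z).hasFDerivAt.prodMk (hasFDerivAt_const z v)).hasMFDerivAt
  have h2 := (hasMFDerivAt_restrictScalars
    (hasMFDerivAt_param (L := L) i (lineCoord i z v, z))).comp v h1
  have h3 : (param L i ∘ fun w : VH k => (lineCoord i z w, z)) = fun w => mk L (w, P1.psi i z) :=
    funext fun w => param_lineCoord L i z w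
  rw [h3] at h2
  refine h2.congr_mfderiv ?_
  ext1 a
  exact fderiv_chart_comp_param (chartAt_symm _) (mem_chart_source (Model k) _) (lineCoord i z a)

/-- The cocycle appears because the preferred chart at the point may belong to the other patch than
`i`. -/
theorem fiberDeriv_eq (i : Fin 2) (z : ℂ) (v a : VH k) :
    fiberDeriv L v (P1.psi i z) a =
      ((cocycle i (P1.index (P1.psi i z)) z • lineCoord i z a, 0) : Model k) := by
  rw [fiberDeriv, (hasMFDerivAt_fiber i z v).mfderiv]
  rfl

theorem lineCoord_bijective (i : Fin 2) (z : ℂ) :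
    Function.Bijective (lineCoord i z : VH k → FiberModel k) :=
  ⟨Function.LeftInverse.injective (fiberChart_lineCoord i z),
    Function.RightInverse.surjective (lineCoord_fiberChart i z)⟩

variable (L) in
theorem hasTwistorFibers : HasTwistorFibers L := by
  intro i z v
  have hc := cocycle_ne_zero (P1.mem_patch_index (P1.psi i z))
  refine ⟨(hasMFDerivAt_fiber i z v).mdifferentiableAt, fun a b h => ?_, ?_, fun a => ?_⟩
  · rw [fiberDeriv_eq, fiberDeriv_eq] at h
    exact (lineCoord_bijective i z).1 (smul_right_injective _ hc (congrArg Prod.fst h))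
  · ext X
    rw [SetLike.mem_coe, mem_vert_iff]
    constructor
    · rintro ⟨a, rfl⟩
      rw [fiberDeriv_eq]
    · intro h
      obtain ⟨a, ha⟩ := (lineCoord_bijective i z).2
        ((cocycle i (P1.index (P1.psi i z)) z)⁻¹ • (X : Model k).1)
      refine ⟨a, ?_⟩
      rw [fiberDeriv_eq, ha, smul_inv_smul₀ hc]
      exact Prod.ext rfl h.symm
  · rw [fiberDeriv_eq, fiberDeriv_eq, lineCoord_rotate_smul, smul_comm]
    exact Prod.ext rfl (smul_zero Complex.I).symm

/-- The coordinates around `z₀` of a tangent vector at `z`. -/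
def tangentCoord (z₀ z : Z L) : Model k →L[ℂ] Model k :=
  fderiv ℂ (chartAt (Model k) z₀ ∘ (chartAt (Model k) z).symm) (chartAt (Model k) z z)

theorem trivializationAt_tangent (z₀ z : Z L) (X : TangentSpace 𝓘(ℂ, Model k) z) :
    (trivializationAt (Model k) (TangentSpace 𝓘(ℂ, Model k)) z₀
      (⟨z, X⟩ : TangentBundle 𝓘(ℂ, Model k) (Z L))).2 = tangentCoord z₀ z X := by
  rw [TangentBundle.trivializationAt_apply, modelWithCornersSelf_coe, range_id,
    fderivWithin_univ]
  rfl

end Z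

/-- The cocycle of `𝒪(1)` between the preferred trivializations at `x` and `x₀`. -/
def pointCocycle (x₀ x : P1) : ℂ :=
  cocycle (P1.index x) (P1.index x₀) (P1.coord (P1.index x) x)

theorem pointCocycle_of_index_eq {x₀ x : P1} (h : P1.index x = P1.index x₀) :
    pointCocycle x₀ x = 1 := if_pos h

theorem localTriv_apply (d : ℤ) {x₀ x : P1} (h : x ∈ P1.patch (P1.index x₀)) (w : ℂ) :
    (trivializationAt ℂ (lineBundle d).Fiber x₀ (⟨x, w⟩ : LineTotal d)).2 =
      pointCocycle x₀ x ^ d * w := by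
  have hx := P1.psi_coord (P1.index x) (P1.mem_patch_index x)
  have := lineBundle_coordChange d (i := P1.index x) (j := P1.index x₀)
    (z := P1.coord (P1.index x) x) (by rwa [hx]) w
  rw [hx] at this
  exact this

namespace Z

variable {L : Submodule ℤ (Fin k → ℂ)} [DiscreteTopology L]

theorem proj_mem_patch {z₀ z : Z L} (h : z ∈ (chartAt (Model k) z₀).source) :
    proj L z ∈ P1.patch (P1.index (proj L z₀)) := by
  rw [← psi_chartAt h]
  exact P1.psi_mem _ _

theorem chartAt_snd (z : Z L) :
    (chartAt (Model k) z z).2 = P1.coord (P1.index (proj L z)) (proj L z) := by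
  have h := congrArg (P1.coord (P1.index (proj L z))) (psi_chartAt (mem_chart_source (Model k) z))
  rwa [P1.coord_psi] at h

/-- The vertical bundle is the pull-back of `ℂ²ᵏ ⊗ 𝒪(1)`; the lattice translation between the two
charts does not enter. -/
theorem tangentCoord_vertical {z₀ z : Z L} (h : z ∈ (chartAt (Model k) z₀).source)
    (u : FiberModel k) :
    tangentCoord z₀ z (u, 0) = (pointCocycle (proj L z₀) (proj L z) • u, 0) := by
  rw [tangentCoord, chartAt_symm, fderiv_chart_comp_param (chartAt_symm z₀), chartAt_snd]
  · rfl
  · rwa [← chartAt_symm, (chartAt (Model k) z).left_inv (mem_chart_source _ _)]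

theorem hasMFDerivAt_chartAt {z₀ z : Z L} (h : z ∈ (chartAt (Model k) z₀).source) :
    HasMFDerivAt 𝓘(ℂ, Model k) 𝓘(ℂ, Model k) (chartAt (Model k) z₀) z (tangentCoord z₀ z) := by
  refine ⟨(chartAt (Model k) z₀).continuousAt h, ?_⟩
  have h1 : param L (P1.index (proj L z)) (chartAt (Model k) z z) ∈
      (chartAt (Model k) z₀).source := by
    rwa [← chartAt_symm, (chartAt (Model k) z).left_inv (mem_chart_source _ _)]
  have hd : DifferentiableAt ℂ (chartAt (Model k) z₀ ∘ (chartAt (Model k) z).symm)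
      (chartAt (Model k) z z) := by
    rw [chartAt_symm]
    exact differentiableAt_chart_comp_param (chartAt_symm z₀) h1
  exact hd.hasFDerivAt.hasFDerivWithinAt

end Z


/-! ## The complex symplectic form along the fibers -/

theorem contDiff_sympl {𝕜 : Type*} [NontriviallyNormedField 𝕜] [NormedAlgebra 𝕜 ℂ]
    {n : WithTop ℕ∞} :
    ContDiff 𝕜 n (fun a : FiberModel k × FiberModel k => sympl a.1 a.2) := by
  unfold sympl
  have h1 (j : Fin k) : ContDiff 𝕜 n fun a : FiberModel k × FiberModel k => a.1.1 j := by fun_prop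
  have h2 (j : Fin k) : ContDiff 𝕜 n fun a : FiberModel k × FiberModel k => a.1.2 j := by fun_prop
  have h3 (j : Fin k) : ContDiff 𝕜 n fun a : FiberModel k × FiberModel k => a.2.1 j := by fun_prop
  have h4 (j : Fin k) : ContDiff 𝕜 n fun a : FiberModel k × FiberModel k => a.2.2 j := by fun_prop
  exact ContDiff.sum fun j _ => ((h1 j).mul (h4 j)).sub ((h2 j).mul (h3 j))

/-- The standard complex symplectic form as an alternating map. -/
def symplForm (k : ℕ) : FiberModel k [⋀^Fin 2]→L[ℂ] ℂ where
  toFun v := sympl (v 0) (v 1)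
  map_update_add' := by
    intro inst v i x y
    obtain rfl : inst = instDecidableEqFin 2 := Subsingleton.elim _ _
    fin_cases i
    · simp [sympl_add_left]
    · simp [sympl_swap x, sympl_swap y, sympl_swap (x + y), sympl_add_left, add_comm]
  map_update_smul' := by
    intro inst v i c x
    obtain rfl : inst = instDecidableEqFin 2 := Subsingleton.elim _ _
    fin_cases i
    · simp [sympl_smul_left]
    · simp [sympl_swap x, sympl_swap (c • x), sympl_smul_left]
  cont := by
    have h : Continuous fun v : Fin 2 → FiberModel k => (v 0, v 1) := by fun_prop
    exact (contDiff_sympl (𝕜 := ℂ) (n := 0)).continuous.comp h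
  map_eq_zero_of_eq' v i j h hij := by
    have : v 0 = v 1 := by fin_cases i <;> fin_cases j <;> simp_all
    rw [this, sympl_self]

namespace Z

variable {L : Submodule ℤ (Fin k → ℂ)} [DiscreteTopology L]

variable (L) in
/-- The relative symplectic form of the twistor space: it is constant in the given coordinates. -/
def form : RelForm (E := Model k) (proj L) := fun z =>
  (symplForm k).compContinuousLinearMap
    ((ContinuousLinearMap.fst ℂ (FiberModel k) ℂ).comp
      ((Vert (E := Model k) (proj L) z).subtypeL : _ →L[ℂ] Model k))

theorem tangentCoord_vert {z₀ z : Z L} (h : z ∈ (chartAt (Model k) z₀).source)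
    (X : Vert (E := Model k) (proj L) z) :
    tangentCoord z₀ z X.1 = (pointCocycle (proj L z₀) (proj L z) • (X.1 : Model k).1, 0) := by
  rw [← tangentCoord_vertical h]
  exact congrArg _ (Prod.ext rfl (mem_vert_iff.1 X.2))

variable (L) in
theorem form_isHolomorphic : (form L).IsHolomorphic := by
  intro U hU X Y hX hY z₀ hz₀
  have hX' := (contMDiffWithinAt_totalSpace.1 (hX z₀ hz₀)).2
  have hY' := (contMDiffWithinAt_totalSpace.1 (hY z₀ hz₀)).2
  refine contMDiffWithinAt_totalSpace.2 ⟨contMDiff_proj.contMDiffAt.contMDiffWithinAt, ?_⟩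
  simp only [trivializationAt_tangent] at hX' hY'
  have hf : ContMDiff 𝓘(ℂ, Model k × Model k) 𝓘(ℂ, ℂ) ω
      (fun a : Model k × Model k => sympl a.1.1 a.2.1) :=
    (contDiff_sympl.comp (ContDiff.prodMk (contDiff_fst.comp contDiff_fst)
      (contDiff_fst.comp contDiff_snd))).contMDiff
  have h := hf.contMDiffAt.comp_contMDiffWithinAt z₀ (hX'.prodMk_space hY')
  -- Both sides carry the square of the cocycle: on the left from `𝒪(2)`, on the right from the two
  -- vertical arguments.
  have key : ∀ z ∈ (chartAt (Model k) z₀).source,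
      (trivializationAt ℂ (lineBundle 2).Fiber (proj L z₀)
        (⟨proj L z, form L z ![X z, Y z]⟩ : LineTotal 2)).2 =
      sympl (tangentCoord z₀ z (X z).1).1 (tangentCoord z₀ z (Y z).1).1 := by
    intro z hz
    refine (localTriv_apply 2 (proj_mem_patch hz) (form L z ![X z, Y z])).trans ?_
    refine Eq.trans ?_ (congrArg₂ sympl (congrArg Prod.fst (tangentCoord_vert hz (X z)))
      (congrArg Prod.fst (tangentCoord_vert hz (Y z)))).symm
    rw [sympl_smul_smul]
    rfl
  refine h.congr_of_eventuallyEq ?_ (key z₀ (mem_chart_source _ _))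
  filter_upwards [mem_nhdsWithin_of_mem_nhds
    ((chartAt (Model k) z₀).open_source.mem_nhds (mem_chart_source (Model k) z₀))] with z hz
  exact key z hz

variable (L) in
theorem form_isNondegenerate : (form L).IsNondegenerate := by
  intro z X hX
  have h : (X.1 : Model k).1 = 0 := sympl_nondegenerate fun w => by
    have hw : ((w, 0) : Model k) ∈ Vert (E := Model k) (proj L) z := mem_vert_iff.2 rfl
    exact hX ⟨((w, 0) : Model k), hw⟩
  exact Subtype.ext (Prod.ext h (mem_vert_iff.1 X.2))

variable (L) in
theorem form_isFiberwiseClosed : (form L).IsFiberwiseClosed := by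
  intro m U hU φ hφ x₀ hx₀ D hD u₀ hu₀
  let f : (Fin m → ℂ) → Model k := chartAt (Model k) (φ u₀) ∘ φ
  have hcont : ContinuousAt φ u₀ := (hφ.continuousOn).continuousAt (hU.mem_nhds hu₀)
  have hf : ContDiffAt ℂ ω f u₀ := by
    have h1 : ContMDiffAt 𝓘(ℂ, Model k) 𝓘(ℂ, Model k) ω (chartAt (Model k) (φ u₀)) (φ u₀) :=
      contMDiffAt_of_mem_maximalAtlas (IsManifold.chart_mem_maximalAtlas _) (mem_chart_source _ _)
    exact (h1.comp u₀ (hφ.contMDiffAt (hU.mem_nhds hu₀))).contDiffAt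
  -- Along a single fiber the patch index is constant, so the cocycle is `1` and the form is the
  -- pull-back of a form with constant coefficients.
  have key : (fun u => (form L (φ u)).compContinuousLinearMap (D u)) =ᶠ[nhds u₀]
      fun u => (symplForm k).compContinuousLinearMap (fderiv ℂ (fun u => (f u).1) u) := by
    filter_upwards [hU.mem_nhds hu₀, hcont.eventually_mem
      ((chartAt (Model k) (φ u₀)).open_source.mem_nhds (mem_chart_source _ _))] with u hu hu'
    have hm := ((hφ.contMDiffAt (hU.mem_nhds hu)).mdifferentiableAt (by simp)).hasMFDerivAt
    have h1 : HasFDerivAt f _ u := ((hasMFDerivAt_chartAt hu').comp u hm).hasFDerivAt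
    have h2 (w : Fin m → ℂ) : fderiv ℂ (fun u => (f u).1) u w = ((D u w).1 : Model k).1 := by
      rw [h1.fst.fderiv]
      change (tangentCoord (φ u₀) (φ u) (mfderiv 𝓘(ℂ, Fin m → ℂ) 𝓘(ℂ, Model k) φ u w)).1 = _
      rw [← hD u hu w, tangentCoord_vert hu', pointCocycle_of_index_eq, one_smul]
      rw [hx₀ u hu, hx₀ u₀ hu₀]
    ext w
    change sympl ((D u (w 0)).1 : Model k).1 ((D u (w 1)).1 : Model k).1 = sympl _ _
    rw [← h2, ← h2]
    rfl
  have hc : DifferentiableAt ℂ (fun _ : FiberModel k => symplForm k) (f u₀).1 :=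
    differentiableAt_const _
  have hf' : ContDiffAt ℂ 2 (fun u => (f u).1) u₀ := (hf.of_le le_top).fst
  rw [key.extDeriv_eq]
  refine (extDeriv_pullback (f := fun u => (f u).1) hc hf' (by simp)).trans ?_
  ext w
  simp [extDeriv, ContinuousAlternatingMap.alternatizeUncurryFin_apply]

variable (L) in
theorem form_isTwistorForm : IsTwistorForm (form L) := by
  intro i z v a b X Y hX hY
  have hp := P1.mem_patch_index (P1.psi i z)
  have hx : P1.psi i z ∈ P1.patch i := P1.psi_mem i z
  rw [fiberDeriv_eq] at hX hY
  have hs : form L (mk L (v, P1.psi i z)) ![X, Y] =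
      cocycle i (P1.index (P1.psi i z)) z ^ (2 : ℤ) * stdForm i z a b := by
    rw [stdForm_eq]
    refine (congrArg₂ sympl (congrArg Prod.fst hX) (congrArg Prod.fst hY)).trans ?_
    rw [sympl_smul_smul]
    rfl
  change (lineBundle 2).coordChange (P1.index (P1.psi i z)) i (P1.psi i z)
    (form L (mk L (v, P1.psi i z)) ![X, Y]) = _
  -- The factor from `fiberDeriv_eq` is the change from trivialization `i` to the preferred one;
  -- reading the value in trivialization `i` undoes it.
  rw [hs, ← lineBundle_coordChange 2 hp,
    (lineBundle 2).coordChange_comp _ _ _ _ ⟨⟨hx, hp⟩, hx⟩, (lineBundle 2).coordChange_self i _ hx]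

end Z


/-! ## The real structure -/

theorem antipodal_psi (i : Fin 2) (z : ℂ) :
    antipodal (P1.psi i z) = P1.psi (1 - i) (-conj z) := by
  have h : antipodal (P1.psi i z) =
      P1.mk (antipodalLift (Function.update (fun _ => 1) i z))
        (by simpa using antipodalLift_injective.ne (P1.update_ne_zero i z)) := rfl
  rw [h, P1.psi, P1.mk_eq_mk_iff]
  fin_cases i <;> simp [antipodalLift]

theorem antipodal_involutive : Function.Involutive antipodal := by
  intro x
  rw [← P1.psi_coord _ (P1.mem_patch_index x), antipodal_psi, antipodal_psi]
  simp

/-- The real structure in the complex coordinates of the twistor space. -/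
def flipL (i : Fin 2) : Model k →L[ℝ] Model k :=
  (flip i).prodMap (-(Complex.conjCLE : ℂ →L[ℝ] ℂ))

theorem flipL_apply (i : Fin 2) (m : Model k) : flipL i m = (flip i m.1, -conj m.2) := rfl

theorem flipL_I_smul (i : Fin 2) (m : Model k) :
    flipL i (Complex.I • m) = -(Complex.I • flipL i m) := by
  rw [flipL_apply, flipL_apply, Prod.smul_fst, flip_I_smul]
  ext1
  · rfl
  · simp

namespace Z

variable (L : Submodule ℤ (Fin k → ℂ))

/-- The real structure of the twistor space. -/
def conjugation : Z L → Z L :=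
  Quotient.map' (s₁ := latticeSetoid L) (s₂ := latticeSetoid L) (fun a => (a.1, antipodal a.2)) (by
    rintro a b ⟨γ, hγ, rfl⟩
    exact ⟨γ, hγ, rfl⟩)

@[simp] theorem conjugation_mk (v : VH k) (x : P1) :
    conjugation L (mk L (v, x)) = mk L (v, antipodal x) := rfl

theorem proj_conjugation (z : Z L) : proj L (conjugation L z) = antipodal (proj L z) := by
  obtain ⟨⟨v, x⟩, rfl⟩ := mk_surjective L z
  rfl

theorem conjugation_involutive : Function.Involutive (conjugation L) := by
  intro z
  obtain ⟨⟨v, x⟩, rfl⟩ := mk_surjective L z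
  rw [conjugation_mk, conjugation_mk, antipodal_involutive]

theorem conjugation_image_twistorLine (v : VH k) :
    conjugation L '' range (twistorLine L v) = range (twistorLine L v) := by
  ext z
  constructor
  · rintro ⟨_, ⟨x, rfl⟩, rfl⟩
    exact ⟨antipodal x, rfl⟩
  · rintro ⟨x, rfl⟩
    exact ⟨_, ⟨antipodal x, rfl⟩, by
      rw [twistorLine, twistorLine, conjugation_mk, antipodal_involutive]⟩

theorem conjugation_param (i : Fin 2) (m : Model k) :
    conjugation L (param L i m) = param L (1 - i) (flipL i m) := by
  obtain ⟨v, hv⟩ := exists_eq_lineCoord i m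
  rw [hv, param_lineCoord, conjugation_mk, flipL_apply, antipodal_psi, ← lineCoord_antipodal,
    param_lineCoord]

variable [DiscreteTopology L]

theorem param_flipL_chartAt {z₀ z : Z L} (h : z ∈ (chartAt (Model k) z₀).source) :
    param L (1 - P1.index (proj L z₀)) (flipL (P1.index (proj L z₀)) (chartAt (Model k) z₀ z)) =
      conjugation L z := by
  rw [← conjugation_param, ← chartAt_symm, (chartAt (Model k) z₀).left_inv h]

theorem continuous_conjugation : Continuous (conjugation L) := by
  rw [continuous_iff_continuousAt]
  intro z
  have h : ContinuousAt (fun y => param L (1 - P1.index (proj L z)) (flipL (P1.index (proj L z))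
      (chartAt (Model k) z y))) z :=
    ((hasTwistorComplexStructure L _).contMDiff.continuous.comp
      (flipL _).continuous).continuousAt.comp
      ((chartAt (Model k) z).continuousAt (mem_chart_source _ _))
  refine h.congr ?_
  filter_upwards [(chartAt (Model k) z).open_source.mem_nhds (mem_chart_source (Model k) z)]
    with y hy
  exact param_flipL_chartAt L hy

theorem hasMFDerivAt_conjugation (z : Z L) :
    HasMFDerivAt 𝓘(ℝ, Model k) 𝓘(ℝ, Model k) (conjugation L) z
      (((fderiv ℂ (chartAt (Model k) (conjugation L z) ∘ param L (1 - P1.index (proj L z)))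
        (flipL (P1.index (proj L z)) (chartAt (Model k) z z))).restrictScalars ℝ).comp
          (flipL (P1.index (proj L z))) : Model k →L[ℝ] Model k) := by
  refine ⟨(continuous_conjugation L).continuousAt, ?_⟩
  -- In charts the map is a holomorphic coordinate change after the real-linear map `flipL`, so
  -- anti-linearity of its differential reduces to that of `flipL`.
  have h : writtenInExtChartAt 𝓘(ℝ, Model k) 𝓘(ℝ, Model k) z (conjugation L) =
      (chartAt (Model k) (conjugation L z) ∘ param L (1 - P1.index (proj L z))) ∘
        flipL (P1.index (proj L z)) := by
    funext m
    change chartAt (Model k) (conjugation L z) (conjugation L ((chartAt (Model k) z).symm m)) = _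
    rw [chartAt_symm, conjugation_param]
    rfl
  rw [h]
  have h2 := (differentiableAt_chart_comp_param (chartAt_symm (conjugation L z))
    (i := 1 - P1.index (proj L z)) (m := flipL (P1.index (proj L z)) (chartAt (Model k) z z))
    (by rw [param_flipL_chartAt L (mem_chart_source _ _)]; exact mem_chart_source _ _)).hasFDerivAt
  exact ((h2.restrictScalars ℝ).comp _ (flipL (P1.index (proj L z))).hasFDerivAt).hasFDerivWithinAt

theorem realDeriv_conjugation (z : Z L) (X : TangentSpace 𝓘(ℂ, Model k) z) :
    realDeriv (E := Model k) (conjugation L) z X =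
      fderiv ℂ (chartAt (Model k) (conjugation L z) ∘ param L (1 - P1.index (proj L z)))
        (flipL (P1.index (proj L z)) (chartAt (Model k) z z)) (flipL (P1.index (proj L z)) X) := by
  rw [realDeriv, (hasMFDerivAt_conjugation L z).mfderiv]
  rfl

theorem isAntiholomorphic_conjugation : IsAntiholomorphic (E := Model k) (conjugation L) := by
  refine ⟨fun z => (hasMFDerivAt_conjugation L z).mdifferentiableAt, fun z X => ?_⟩
  rw [realDeriv_conjugation, realDeriv_conjugation]
  refine (congrArg _ (flipL_I_smul _ _)).trans ?_
  rw [map_neg, map_smul]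
  rfl

theorem realDeriv_conjugation_vertical (z : Z L) {X : TangentSpace 𝓘(ℂ, Model k) z}
    (hX : X ∈ Vert (E := Model k) (proj L) z) :
    realDeriv (E := Model k) (conjugation L) z X =
      ((cocycle (1 - P1.index (proj L z)) (P1.index (proj L (conjugation L z)))
        (-conj (chartAt (Model k) z z).2) • flip (P1.index (proj L z)) (X : Model k).1, 0) :
          Model k) := by
  rw [realDeriv_conjugation]
  have h : flipL (P1.index (proj L z)) (X : Model k) =
      (flip (P1.index (proj L z)) (X : Model k).1, 0) := by
    refine Prod.ext rfl ((congrArg (fun t : ℂ => -conj t) (mem_vert_iff.1 hX)).trans ?_)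
    simp
  refine (congrArg _ h).trans ?_
  rw [fderiv_chart_comp_param (chartAt_symm _) (by
    rw [param_flipL_chartAt L (mem_chart_source _ _)]; exact mem_chart_source _ _)]
  rfl

end Z

/-- Written with the same cocycle as `realDeriv_conjugation_vertical`, so that for `d = 2` the two
factors match. -/
theorem lineConj_mk (d : ℤ) (x : P1) (w : ℂ) :
    lineConj d ⟨x, w⟩ = ⟨antipodal x, cocycle (1 - P1.index x) (P1.index (antipodal x))
      (-conj (P1.coord (P1.index x) x)) ^ d * conj w⟩ := by
  have hx := P1.psi_coord _ (P1.mem_patch_index x)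
  have h1 : fiberCoord d (P1.index x) ⟨x, w⟩ = w :=
    (lineBundle d).coordChange_self _ _ (P1.mem_patch_index x) w
  have h2 : antipodal x = P1.psi (1 - P1.index x) (-conj (P1.coord (P1.index x) x)) := by
    rw [← antipodal_psi, hx]
  have h3 := lineBundle_coordChange d (i := 1 - P1.index x) (j := P1.index (antipodal x))
    (z := -conj (P1.coord (P1.index x) x)) (by rw [← h2]; exact P1.mem_patch_index _) (conj w)
  rw [← h2] at h3
  rw [← h3, lineConj, h1]

namespace Z

variable (L : Submodule ℤ (Fin k → ℂ)) [DiscreteTopology L]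

theorem form_isAntiReal : (form L).IsAntiReal (conjugation L) := by
  intro z
  refine ⟨fun X => ?_, fun X Y => ?_⟩
  · exact mem_vert_iff.2 (congrArg Prod.snd (realDeriv_conjugation_vertical L z X.2))
  · obtain ⟨⟨v, x⟩, rfl⟩ := mk_surjective L z
    refine Eq.trans ?_ (lineConj_mk 2 x _).symm
    refine congrArg (TotalSpace.mk (antipodal x)) ?_
    refine (congrArg₂ sympl (congrArg Prod.fst (realDeriv_conjugation_vertical L _ X.2))
      (congrArg Prod.fst (realDeriv_conjugation_vertical L _ Y.2))).trans ?_
    rw [sympl_smul_smul, sympl_flip, chartAt_snd, ← map_neg]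
    rfl

end Z


/-! ## Twistor lines and their normal bundles -/

/-- The slope of a twistor line in affine coordinates. -/
def slope (i : Fin 2) (v : VH k) : FiberModel k := if i = 0 then splitKL v else splitL v

theorem hasDerivAt_lineCoord (i : Fin 2) (z : ℂ) (v : VH k) :
    HasDerivAt (fun t => (lineCoord i t v, t)) ((slope i v, 1) : Model k) z := by
  refine HasDerivAt.prodMk ?_ (hasDerivAt_id z)
  unfold lineCoord alpha beta slope
  split_ifs
  · simpa using HasDerivAt.const_add ((1 : ℂ) • splitL v)
      ((hasDerivAt_id z).smul_const (splitKL v))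
  · simpa using HasDerivAt.add_const ((1 : ℂ) • splitKL v)
      ((hasDerivAt_id z).smul_const (splitL v))

namespace Z

variable {L : Submodule ℤ (Fin k → ℂ)} [DiscreteTopology L]

variable (L) in
theorem contMDiff_twistorLine (v : VH k) :
    ContMDiff 𝓘(ℂ, ℂ) 𝓘(ℂ, Model k) ω (twistorLine L v) := by
  intro x
  have h1 : ContMDiff 𝓘(ℂ, ℂ) 𝓘(ℂ, Model k) ω
      (fun t => ((lineCoord (P1.index x) t v, t) : Model k)) :=
    ((contDiff_lineCoord_const _ v).prodMk contDiff_id).contMDiff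
  have h2 : ContMDiff 𝓘(ℂ, Model k) 𝓘(ℂ, Model k) ω (param L (P1.index x)) :=
    (hasTwistorComplexStructure L _).contMDiff
  have h3 : ContMDiffAt 𝓘(ℂ, ℂ) 𝓘(ℂ, ℂ) ω (P1.coord (P1.index x)) x :=
    (P1.contMDiffOn_coord _).contMDiffAt ((P1.isOpen_patch _).mem_nhds (P1.mem_patch_index x))
  refine ((h2.comp h1).contMDiffAt.comp x h3).congr_of_eventuallyEq ?_
  filter_upwards [(P1.isOpen_patch _).mem_nhds (P1.mem_patch_index x)] with y hy
  change _ = param L _ (lineCoord _ _ v, _)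
  rw [param_lineCoord, P1.psi_coord _ hy]
  rfl

theorem isHolomorphicSection_twistorLine (v : VH k) :
    IsHolomorphicSection (E := Model k) (proj L) (twistorLine L v) :=
  ⟨contMDiff_twistorLine L v, fun _ => rfl⟩

variable (L) in
/-- The differential of a twistor line. -/
def twistorLineDeriv (v : VH k) (x : P1) : ℂ →L[ℂ] Model k :=
  mfderiv 𝓘(ℂ, ℂ) 𝓘(ℂ, Model k) (twistorLine L v) x

variable (L) in
/-- The velocity of a twistor line. -/
def velocity (v : VH k) (x : P1) : Model k := twistorLineDeriv L v x 1

theorem twistorLineDeriv_apply (v : VH k) (x : P1) (t : ℂ) :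
    twistorLineDeriv L v x t = t • velocity L v x := by
  rw [velocity, ← map_smul, smul_eq_mul, mul_one]

theorem hasMFDerivAt_twistorLine (v : VH k) (x : P1) :
    HasMFDerivAt 𝓘(ℂ, ℂ) 𝓘(ℂ, Model k) (twistorLine L v) x (twistorLineDeriv L v x) :=
  ((contMDiff_twistorLine L v).mdifferentiable (by simp) x).hasMFDerivAt

theorem velocity_snd (v : VH k) (x : P1) : (velocity L v x).2 = 1 := by
  have h1 := (hasMFDerivAt_proj (twistorLine L v x)).comp x (hasMFDerivAt_twistorLine v x)
  -- The twistor line is a section, so this composition is the identity.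
  have h2 : HasMFDerivAt 𝓘(ℂ, ℂ) 𝓘(ℂ, ℂ) (proj L ∘ twistorLine L v) x
      (ContinuousLinearMap.id ℂ (TangentSpace 𝓘(ℂ, ℂ) x)) := hasMFDerivAt_id x
  exact congrArg (fun D : ℂ →L[ℂ] ℂ => D 1) (hasMFDerivAt_unique h1 h2)

/-- Around a point a twistor line is affine in the given coordinates. -/
theorem exists_chart_twistorLine (v : VH k) (x₀ : P1) : ∃ w : VH k, ∀ᶠ y in nhds x₀,
    chartAt (Model k) (twistorLine L v x₀) (twistorLine L v y) =
      (lineCoord (P1.index x₀) (P1.coord (P1.index x₀) y) w, P1.coord (P1.index x₀) y) := by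
  have hx := P1.psi_coord _ (P1.mem_patch_index x₀)
  have hs : ∀ y ∈ P1.patch (P1.index x₀), param L (P1.index x₀)
      (lineCoord (P1.index x₀) (P1.coord (P1.index x₀) y) v, P1.coord (P1.index x₀) y) =
        twistorLine L v y := by
    intro y hy
    rw [param_lineCoord, P1.psi_coord _ hy]
    rfl
  have he : ⇑(chartAt (Model k) (twistorLine L v x₀)).symm = param L (P1.index x₀) :=
    chartAt_symm (twistorLine L v x₀)
  obtain ⟨hp, γ, _, h⟩ := chart_comp_param_eventuallyEq he (i := P1.index x₀)
    (m := (lineCoord (P1.index x₀) (P1.coord (P1.index x₀) x₀) v, P1.coord (P1.index x₀) x₀))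
    (by rw [hs _ (P1.mem_patch_index x₀)]; exact mem_chart_source _ _)
  -- The preferred chart may see the line through a lattice translate of `v`.
  refine ⟨v + toVH γ, ?_⟩
  have hc : ContinuousAt (fun y => ((lineCoord (P1.index x₀) (P1.coord (P1.index x₀) y) v,
      P1.coord (P1.index x₀) y) : Model k)) x₀ := by
    have h1 : ContinuousAt (P1.coord (P1.index x₀)) x₀ :=
      (P1.continuousOn_coord _).continuousAt
        ((P1.isOpen_patch _).mem_nhds (P1.mem_patch_index x₀))
    exact ((contDiff_lineCoord_const (P1.index x₀) v).continuous.continuousAt.comp h1).prodMk h1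
  filter_upwards [hc.eventually h, (P1.isOpen_patch _).mem_nhds (P1.mem_patch_index x₀)]
    with y hy hy'
  rw [Function.comp_apply, hs y hy', transition_lineCoord (P1.psi_mem _ _)] at hy
  rw [hy, affineChange, if_pos rfl]

variable (L) in
/-- Taking the vertical part identifies the normal bundle of a twistor line. -/
def vertPart (v : VH k) (x : P1) : Model k →ₗ[ℂ] FiberModel k :=
  LinearMap.fst ℂ (FiberModel k) ℂ -
    (LinearMap.snd ℂ (FiberModel k) ℂ).smulRight (velocity L v x).1

theorem vertPart_apply (v : VH k) (x : P1) (X : Model k) :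
    vertPart L v x X = X.1 - X.2 • (velocity L v x).1 := rfl

/-- The vertical part of a tangent vector in the coordinates around a nearby point. -/
theorem exists_tangentCoord_twistorLine (v : VH k) (x₀ : P1) :
    ∃ w : FiberModel k, ∀ᶠ y in nhds x₀,
      twistorLine L v y ∈ (chartAt (Model k) (twistorLine L v x₀)).source ∧
      ∀ X : Model k, pointCocycle x₀ y • vertPart L v y X =
        (tangentCoord (twistorLine L v x₀) (twistorLine L v y) X).1 -
          (tangentCoord (twistorLine L v x₀) (twistorLine L v y) X).2 • w := by
  obtain ⟨w, hw⟩ := exists_chart_twistorLine (L := L) v x₀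
  refine ⟨slope (P1.index x₀) w, ?_⟩
  have hsrc : ∀ᶠ y in nhds x₀,
      twistorLine L v y ∈ (chartAt (Model k) (twistorLine L v x₀)).source :=
    (contMDiff_twistorLine L v).continuous.continuousAt.eventually_mem
      ((chartAt (Model k) _).open_source.mem_nhds (mem_chart_source _ _))
  filter_upwards [hw.eventually_nhds, hsrc, (P1.isOpen_patch _).mem_nhds (P1.mem_patch_index x₀)]
    with y hy hy' hyp
  refine ⟨hy', fun X => ?_⟩
  have h1 := (hasMFDerivAt_chartAt hy').comp y (hasMFDerivAt_twistorLine v y)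
  -- The value of `D` is irrelevant: the transported velocity is a multiple of `(slope, 1)`, which
  -- the combination `T.1 - T.2 • slope` kills.
  obtain ⟨D, h2⟩ : ∃ D : ℂ →L[ℂ] ℂ,
      HasMFDerivAt 𝓘(ℂ, ℂ) 𝓘(ℂ, ℂ) (P1.coord (P1.index x₀)) y D :=
    ⟨_, (((P1.contMDiffOn_coord _).contMDiffAt
      ((P1.isOpen_patch _).mem_nhds hyp)).mdifferentiableAt (by simp)).hasMFDerivAt⟩
  have h3 := ((hasDerivAt_lineCoord (P1.index x₀) (P1.coord (P1.index x₀) y)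
    w).hasFDerivAt.hasMFDerivAt.comp y h2).congr_of_eventuallyEq hy
  have h4 : tangentCoord (twistorLine L v x₀) (twistorLine L v y) (velocity L v y) =
      D 1 • ((slope (P1.index x₀) w, 1) : Model k) :=
    congrArg (fun D : ℂ →L[ℂ] Model k => D 1) (hasMFDerivAt_unique h1 h3)
  have h5 : X = ((vertPart L v y X, 0) : Model k) + X.2 • velocity L v y := by
    ext1
    · simp [vertPart_apply]
    · simp [velocity_snd]
  have h6 : tangentCoord (twistorLine L v x₀) (twistorLine L v y) X =
      (pointCocycle x₀ y • vertPart L v y X, 0) +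
        X.2 • D 1 • ((slope (P1.index x₀) w, 1) : Model k) := by
    conv_lhs => rw [h5]
    rw [map_add, map_smul, h4, tangentCoord_vertical hy']
    rfl
  rw [h6]
  simp [smul_smul]

theorem ker_vertPart (v : VH k) (x : P1) :
    LinearMap.ker (vertPart L v x) =
      LinearMap.range (twistorLineDeriv L v x).toLinearMap := by
  ext X
  rw [LinearMap.mem_ker, vertPart_apply, sub_eq_zero, LinearMap.mem_range]
  constructor
  · intro h
    refine ⟨X.2, (twistorLineDeriv_apply v x X.2).trans (Prod.ext h.symm ?_)⟩
    rw [Prod.smul_snd, velocity_snd, smul_eq_mul, mul_one]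
  · rintro ⟨t, rfl⟩
    change (twistorLineDeriv L v x t).1 = (twistorLineDeriv L v x t).2 • _
    rw [twistorLineDeriv_apply, Prod.smul_fst, Prod.smul_snd, velocity_snd, smul_eq_mul, mul_one]

theorem vertPart_surjective (v : VH k) (x : P1) :
    Function.Surjective (vertPart L v x) :=
  fun u => ⟨(u, 0), by rw [vertPart_apply, zero_smul, sub_zero]⟩

/-- The normal space of a twistor line is the vertical tangent space. -/
def normalEquiv (v : VH k) (x : P1) :
    NormalSpace (E := Model k) (twistorLine L v) x ≃ₗ[ℂ] FiberModel k :=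
  (Submodule.quotEquivOfEq _ _ (ker_vertPart v x).symm).trans
    ((vertPart L v x).quotKerEquivOfSurjective (vertPart_surjective v x))

theorem normalEquiv_mk (v : VH k) (x : P1) (X : Model k) :
    normalEquiv (L := L) v x (Submodule.Quotient.mk X) = vertPart L v x X := rfl

end Z

/-- A linear isomorphism between `ℂᵏ × ℂᵏ` and `ℂ²ᵏ`. -/
def fiberModelEquiv (k : ℕ) : FiberModel k ≃L[ℂ] (Fin (2 * k) → ℂ) :=
  -- Any fixed isomorphism serves, since the scalar cocycle commutes with it.
  ContinuousLinearEquiv.ofFinrankEq (by simp [two_mul])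

namespace Z

variable {L : Submodule ℤ (Fin k → ℂ)} [DiscreteTopology L]

theorem normalBundleIso_twistorLine (v : VH k) :
    NormalBundleIso (E := Model k) (twistorLine L v) (2 * k) 1 := by
  refine ⟨fun x => (normalEquiv v x).trans (fiberModelEquiv k).toLinearEquiv, fun U hU σ => ?_⟩
  have htriv : ∀ x₀ y : P1, y ∈ P1.patch (P1.index x₀) → ∀ j,
      (trivializationAt ℂ (lineBundle 1).Fiber x₀
        (⟨y, fiberModelEquiv k (normalEquiv v y (σ y)) j⟩ :
        LineTotal 1)).2 =
      fiberModelEquiv k (pointCocycle x₀ y • normalEquiv v y (σ y)) j := by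
    intro x₀ y hy j
    refine (localTriv_apply 1 hy (fiberModelEquiv k (normalEquiv v y (σ y)) j)).trans ?_
    rw [map_smul, Pi.smul_apply, smul_eq_mul, zpow_one]
  constructor
  · intro h j x₀ hx₀
    obtain ⟨W, hW, hxW, hWU, Y, hY, hYσ⟩ := h x₀ hx₀
    have hY' := (contMDiffWithinAt_totalSpace.1 (hY x₀ hxW)).2.contMDiffAt (hW.mem_nhds hxW)
    simp only [trivializationAt_tangent] at hY'
    obtain ⟨w, hw⟩ := exists_tangentCoord_twistorLine (L := L) v x₀
    refine ContMDiffAt.contMDiffWithinAt (contMDiffAt_totalSpace.2 ⟨contMDiffAt_id, ?_⟩)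
    -- The vector `w` does not depend on the point, so taking vertical parts in the chart around
    -- `x₀` is a fixed linear map.
    have hf : ContMDiff 𝓘(ℂ, Model k) 𝓘(ℂ, ℂ) ω
        (fun X : Model k => fiberModelEquiv k (X.1 - X.2 • w) j) := by
      refine ContDiff.contMDiff ?_
      have h1 : ContDiff ℂ ω fun X : Model k => X.1 - X.2 • w :=
        contDiff_fst.sub (contDiff_snd.smul contDiff_const)
      exact contDiff_pi.1 ((fiberModelEquiv k).contDiff.comp h1) j
    refine (hf.contMDiffAt.comp x₀ hY').congr_of_eventuallyEq ?_
    filter_upwards [hw, hW.mem_nhds hxW,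
      (P1.isOpen_patch _).mem_nhds (P1.mem_patch_index x₀)] with y hy hyW hyp
    refine (htriv x₀ y hyp j).trans ?_
    rw [← hYσ y hyW]
    exact congrArg (fun u => fiberModelEquiv k u j) (hy.2 (Y y))
  · intro h x hx
    -- The vertical representative of the normal vector gives a lift on all of `U`.
    refine ⟨U, hU, hx, subset_rfl, fun y => ((normalEquiv v y (σ y), 0) : Model k), ?_, ?_⟩
    · intro x₀ hx₀
      refine ContMDiffAt.contMDiffWithinAt (contMDiffAt_totalSpace.2
        ⟨(contMDiff_twistorLine L v).contMDiffAt, ?_⟩)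
      have h1 (j : Fin (2 * k)) := (contMDiffAt_totalSpace.1
        ((h j x₀ hx₀).contMDiffAt (hU.mem_nhds hx₀))).2
      have h2 := contMDiffAt_pi_space.2 h1
      have hf : ContMDiff 𝓘(ℂ, Fin (2 * k) → ℂ) 𝓘(ℂ, Model k) ω
          (fun u => (((fiberModelEquiv k).symm u, 0) : Model k)) :=
        ((fiberModelEquiv k).symm.contDiff.prodMk contDiff_const).contMDiff
      obtain ⟨w, hw⟩ := exists_tangentCoord_twistorLine (L := L) v x₀
      refine (hf.contMDiffAt.comp x₀ h2).congr_of_eventuallyEq ?_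
      filter_upwards [hw, (P1.isOpen_patch _).mem_nhds (P1.mem_patch_index x₀)] with y hy hyp
      refine (trivializationAt_tangent _ _ _).trans ((tangentCoord_vertical hy.1 _).trans ?_)
      refine Prod.ext ?_ rfl
      refine Eq.trans ?_ (congrArg (fiberModelEquiv k).symm
        (funext fun j => (htriv x₀ y hyp j).symm))
      exact ((fiberModelEquiv k).symm_apply_apply _).symm
    · intro y _
      refine (normalEquiv v y).injective ?_
      refine (normalEquiv_mk v y _).trans ?_
      rw [vertPart_apply, zero_smul, sub_zero]

end Z

end HKTwistor

end

theorem mainTheorem8 (k : ℕ) (L : Submodule ℤ (Fin k → ℂ)) [DiscreteTopology L] [IsZLattice ℝ L] :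
    T2Space (HKTwistor.Z L) ∧ SecondCountableTopology (HKTwistor.Z L) ∧
    ∃ cs : ChartedSpace (HKTwistor.Model k) (HKTwistor.Z L),
    ∃ _ : IsManifold 𝓘(ℂ, HKTwistor.Model k) ω (HKTwistor.Z L),
      -- the complex structure of the twistor space
      HKTwistor.HasTwistorComplexStructure L ∧
      HKTwistor.IsSmoothQuotientOfProduct L ∧
      HKTwistor.HasTwistorFibers L ∧
      -- fibered holomorphically over the projective line
      HKTwistor.IsHolomorphicFibration (E := HKTwistor.Model k) (HKTwistor.Z.proj L) ∧
      -- the twistor lines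
      (∀ v : HKTwistor.VH k,
        HKTwistor.IsHolomorphicSection (E := HKTwistor.Model k) (HKTwistor.Z.proj L)
          (HKTwistor.twistorLine L v) ∧
        HKTwistor.NormalBundleIso (E := HKTwistor.Model k) (HKTwistor.twistorLine L v)
          (2 * k) 1) ∧
      -- the complex symplectic form along the fibers, with values in the pull-back of `𝒪(2)`
      ∃ Ω : HKTwistor.RelForm (E := HKTwistor.Model k) (HKTwistor.Z.proj L),
        Ω.IsHolomorphic ∧ Ω.IsFiberwiseClosed ∧ Ω.IsNondegenerate ∧
        HKTwistor.IsTwistorForm Ω ∧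
        -- the real structure
        ∃ τ : HKTwistor.Z L → HKTwistor.Z L,
          HKTwistor.IsAntiholomorphic (E := HKTwistor.Model k) τ ∧
          Function.Involutive τ ∧
          (∀ z, HKTwistor.Z.proj L (τ z) = HKTwistor.antipodal (HKTwistor.Z.proj L z)) ∧
          (∀ v : HKTwistor.VH k,
            τ '' range (HKTwistor.twistorLine L v) = range (HKTwistor.twistorLine L v)) ∧
          Ω.IsAntiReal τ := by
  refine ⟨inferInstance, inferInstance, inferInstance, inferInstance,
    HKTwistor.Z.hasTwistorComplexStructure L, HKTwistor.Z.isSmoothQuotientOfProduct L,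
    HKTwistor.Z.hasTwistorFibers L, HKTwistor.Z.isHolomorphicFibration, fun v =>
      ⟨HKTwistor.Z.isHolomorphicSection_twistorLine v, HKTwistor.Z.normalBundleIso_twistorLine v⟩,
    HKTwistor.Z.form L, HKTwistor.Z.form_isHolomorphic L, HKTwistor.Z.form_isFiberwiseClosed L,
    HKTwistor.Z.form_isNondegenerate L, HKTwistor.Z.form_isTwistorForm L,
    HKTwistor.Z.conjugation L, HKTwistor.Z.isAntiholomorphic_conjugation L,
    HKTwistor.Z.conjugation_involutive L, HKTwistor.Z.proj_conjugation L,
    HKTwistor.Z.conjugation_image_twistorLine L, HKTwistor.Z.form_isAntiReal L⟩
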